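/- A \emph{$5/4$-power} is a finite word of the form $xyx$ with $x$ nonempty and $|y|=3|x|$; an infinite word is \emph{$5/4$-power-free} if none of its factors is a $5/4$-power. Let $\Sigma_8=\{n_j : n\in\mathbb{Z},\ 0\le j\le 7\}$, let $\tau$ be the coding $\tau(n_j)=n$, and let $\varphi$ be the $6$-uniform morphism on $\Sigma_8$ defined, for all $n\in\mathbb{Z}$, by \begin{align*} \varphi(n_0) &= 0_0 1_1 0_2 0_3 1_4 (n+3)_5, & \varphi(n_4) &= 0_0 1_1 0_2 0_3 1_4 (n+1)_5,\\ \varphi(n_1) &= 1_6 1_7 0_0 0_1 0_2 (n+2)_3, & \varphi(n_5) &= 1_6 1_7 0_0 0_1 0_2 (n+2)_3,\\ \varphi(n_2) &= 1_4 1_5 1_6 0_7 0_0 (n+3)_1, & \varphi(n_6) &= 1_4 1_5 1_6 0_7 0_0 (n+1)_1,\\ \varphi(n_3) &= 0_2 1_3 1_4 0_5 1_6 (n+2)_7, & \varphi(n_7) &= 0_2 1_3 1_4 0_5 1_6 (n+2)_7. \end{align*} A word on $\Sigma_8$ is \emph{subscript-increasing} if its subscripts increase by $1$ modulo $8$ from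 each letter to the next. \textbf{Theorem.} The lexicographically least $5/4$-power-free infinite word $\mathbf{w}_{5/4}=w(0)w(1)\cdots$ on the alphabet $\{0,1,2,\dots\}$ exists, and decreasing any nonzero letter $w(n)$ to a smaller nonnegative integer produces a $5/4$-power ending at position $n$. Let $\mathbf{p}$ be the length-$6764$ prefix of $\mathbf{w}_{5/4}$. There is a subscript-increasing word \[ \mathbf{z} = 0_2 0_3 3_4 0_5 1_6 1_7 (-1)_0 2_1 0_2 2_3 2_4 0_5 \cdots 0_0 1_1 0_2 0_3 1_4 2_5 1_6 2_7 0_0 0_1 0_2 3_3 \] on $\Sigma_8$ of length $20226$ such that $\tau(\varphi(\mathbf{z})) = w(6764)w(6765)\cdots w(6764+6\cdot 20226-1)$ (these conditions determine $\mathbf{z}$ uniquely), and \[ \mathbf{w}_{5/4}=\mathbf{p}\,\tau\bigl(\varphi(\mathbf{z})\,\varphi^2(\mathbf{z})\,\varphi^3(\mathbf{z})\cdots\bigr). \] -/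

import Mathlib

namespace FiveFourths

/-- The factor of length `m` of the infinite word `w` that starts at position `i`. -/
def factor {α : Type*} (w : ℕ → α) (i m : ℕ) : List α :=
  (List.range m).map fun k => w (i + k)

/-- A `5/4`-power: a finite word `x y x` with `x` nonempty and `|y| = 3 |x|`,
that is, `(x y)^(5/4)`. -/
def IsFiveFourthsPower {α : Type*} (v : List α) : Prop :=
  ∃ x y : List α, x ≠ [] ∧ y.length = 3 * x.length ∧ v = x ++ y ++ x

/-- No factor of the infinite word `w` is a `5/4`-power. -/
def FiveFourthsPowerFree {α : Type*} (w : ℕ → α) : Prop :=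
  ∀ i m : ℕ, ¬ IsFiveFourthsPower (factor w i m)

/-- `w` is the least element, for the lexicographic order on infinite words on the nonnegative
integers, of the set of all `5/4`-power-free infinite words. -/
def IsLexLeastFiveFourthsPowerFree (w : ℕ → ℕ) : Prop :=
  IsLeast {v : Lex (ℕ → ℕ) | FiveFourthsPowerFree (ofLex v)} (toLex w)

/-- The infinite word `w` has a `5/4`-power factor whose last letter is at position `n`. -/
def HasFiveFourthsPowerEndingAt {α : Type*} (w : ℕ → α) (n : ℕ) : Prop :=
  ∃ i m : ℕ, i + m = n + 1 ∧ IsFiveFourthsPower (factor w i m)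

/-- The alphabet of the letters `n_j` with `n` an integer and `j` in `{0, ..., 7}`;
the letter `n_j` is the pair `(n, j)`. -/
abbrev Sigma8 : Type := ℤ × Fin 8

/-- The `6`-uniform morphism on letters. -/
def phi : Sigma8 → List Sigma8
  | (n, 0) => [(0, 0), (1, 1), (0, 2), (0, 3), (1, 4), (n + 3, 5)]
  | (n, 1) => [(1, 6), (1, 7), (0, 0), (0, 1), (0, 2), (n + 2, 3)]
  | (n, 2) => [(1, 4), (1, 5), (1, 6), (0, 7), (0, 0), (n + 3, 1)]
  | (n, 3) => [(0, 2), (1, 3), (1, 4), (0, 5), (1, 6), (n + 2, 7)]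
  | (n, 4) => [(0, 0), (1, 1), (0, 2), (0, 3), (1, 4), (n + 1, 5)]
  | (n, 5) => [(1, 6), (1, 7), (0, 0), (0, 1), (0, 2), (n + 2, 3)]
  | (n, 6) => [(1, 4), (1, 5), (1, 6), (0, 7), (0, 0), (n + 1, 1)]
  | (n, 7) => [(0, 2), (1, 3), (1, 4), (0, 5), (1, 6), (n + 2, 7)]

/-- The morphism on finite words, by concatenation. -/
def phiWord (u : List Sigma8) : List Sigma8 := u.flatMap phi

/-- The coding `n_j ↦ n`. -/
def tau (a : Sigma8) : ℤ := a.1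

/-- The subscripts increase by `1` modulo `8` from one letter to the next
(addition in `Fin 8` is modulo `8`). -/
def SubscriptIncreasing (u : List Sigma8) : Prop :=
  u.IsChain fun a b => b.2 = a.2 + 1

/-- The infinite word `u 0 u 1 u 2 ⋯`, for nonempty finite words `u k`. As the words are nonempty,
`u 0 u 1 ⋯ u n` has more than `n` letters, so that the default letter is never used. -/
def concatWord {α : Type*} [Inhabited α] (u : ℕ → List α) (n : ℕ) : α :=
  ((List.range (n + 1)).flatMap u).getD n default

/-- The infinite word `p x`, for a finite word `p` and an infinite word `x`. -/
def prependWord {α : Type*} (p : List α) (x : ℕ → α) (n : ℕ) : α :=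
  if h : n < p.length then p[n] else x (n - p.length)

end FiveFourths

open FiveFourths

/-! The tail of the word is self-similar. From position 6760 on, the letters at offsets `m` with `m
% 6 ≠ 3` are 0 or 1 and repeat with period 24. The remaining letters form `core`. Beyond index
20223, `core` replays the tail of the word itself, each letter raised by an `increment` of period 8.
This is the morphism read column by column; with finitely many explicit letters it defines `word`.

Avoidance is a descent on the length `l` of `x` (`not_repeats_core`). Letters of `core` are at least
2 and the periodic ones at most 1, so a repetition in the tail forces `6 ∣ l`, and sampling the
`core` column gives a repetition of length `l / 6` in `core`. There, letters at even offsets are 3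
or 2 according to the offset modulo 8, which rules out odd lengths (length 1 at an odd offset is
treated apart). For an even length the shift is a multiple of 8, the increments cancel, and the
repetition comes from one of the same length in the tail. That length is again divisible by 6, so a
shorter repetition in `core` results. Repetitions that start before the self-similar region are
either covered by evaluation or contradicted by the letter just before its boundary.

Minimality (`exists_bans_word`) runs the same correspondence upwards. A periodic 1 cannot become 0
because the letter four places earlier is 0. At a `core` position, 0 and 1 are excluded by short
powers, and larger values by powers of `core` inflated by 6 (`Bans.word_of_core`). Those come by
induction from powers in the tail raised by the increments (`Bans.core_of_word`), with base cases by
evaluation. Together, avoidance and minimality give the lexicographically least word, since a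
smaller word would contain a power ending at the first difference.

For the morphic form, `lift` subtracts the increments from `core` and attaches subscripts;
`phi_lift` says that `phi` maps its letters to consecutive blocks of six letters of `lift` itself.
-/

namespace FiveFourths

/-! ### Words as numbers in base `16` -/

/-- The hexadecimal digit of `x` at position `i`, counted from the least significant one. -/
def letter (x i : ℕ) : ℕ := (x >>> (4 * i)) % 16

/-- The number formed by the lowest `n` hexadecimal digits of `x`. -/
def low (x n : ℕ) : ℕ := Nat.land x (Nat.sub (Nat.pow 2 (Nat.mul 4 n)) 1)

/-- The number obtained from `x` by deleting its lowest `n` hexadecimal digits. -/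
def drop (x n : ℕ) : ℕ := Nat.shiftRight x (Nat.mul 4 n)

/-- The digits of `a` at the positions below `n`, followed by those of `b`. -/
def append (a n b : ℕ) : ℕ := Nat.add a (Nat.shiftLeft b (Nat.mul 4 n))

theorem low_eq_mod (x n : ℕ) : low x n = x % 2 ^ (4 * n) :=
  Nat.and_two_pow_sub_one_eq_mod x (4 * n)

theorem drop_eq_div (x n : ℕ) : drop x n = x / 2 ^ (4 * n) :=
  Nat.shiftRight_eq_div_pow x (4 * n)

theorem append_eq (a n b : ℕ) : append a n b = a + 2 ^ (4 * n) * b := by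
  change a + b <<< (4 * n) = _
  rw [Nat.shiftLeft_eq, mul_comm]

theorem letter_eq (x i : ℕ) : letter x i = x / 16 ^ i % 16 := by
  rw [letter, Nat.shiftRight_eq_div_pow, pow_mul]; norm_num

theorem letter_lt (x i : ℕ) : letter x i < 16 := Nat.mod_lt _ (by norm_num)

theorem letter_drop (x n i : ℕ) : letter (drop x n) i = letter x (n + i) := by
  simp only [letter_eq, drop_eq_div, pow_mul, Nat.div_div_eq_div_mul, pow_add]; norm_num

theorem letter_low {x n i : ℕ} (h : i < n) : letter (low x n) i = letter x i := by
  obtain ⟨k, rfl⟩ := Nat.exists_eq_add_of_lt h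
  simp only [letter_eq, low_eq_mod, pow_mul]
  norm_num
  rw [show i + k + 1 = i + (k + 1) by ring, pow_add, Nat.mod_mul_right_div_self, pow_succ',
    Nat.mod_mul_right_mod]

theorem letter_low_of_le {x n i : ℕ} (h : n ≤ i) : letter (low x n) i = 0 := by
  rw [letter_eq, low_eq_mod, Nat.div_eq_of_lt, Nat.zero_mod]
  calc x % 2 ^ (4 * n) < 2 ^ (4 * n) := Nat.mod_lt _ (by positivity)
    _ = 16 ^ n := by rw [pow_mul]; norm_num
    _ ≤ 16 ^ i := Nat.pow_le_pow_right (by norm_num) h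

theorem letter_append {a n b i : ℕ} (ha : a < 2 ^ (4 * n)) :
    letter (append a n b) i = if i < n then letter a i else letter b (i - n) := by
  split_ifs with h
  · rw [← letter_low h, low_eq_mod, append_eq, Nat.add_mul_mod_self_left, ← low_eq_mod,
      letter_low h]
  · obtain ⟨k, rfl⟩ := Nat.exists_eq_add_of_le (not_lt.mp h)
    rw [← letter_drop, drop_eq_div, append_eq, Nat.add_mul_div_left _ _ (by positivity),
      Nat.div_eq_of_lt ha, zero_add, Nat.add_sub_cancel_left]

theorem append_lt {a n b m : ℕ} (ha : a < 2 ^ (4 * n)) (hb : b < 2 ^ (4 * m)) :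
    append a n b < 2 ^ (4 * (n + m)) := by
  rw [append_eq, mul_add, pow_add]
  calc a + 2 ^ (4 * n) * b < 2 ^ (4 * n) + 2 ^ (4 * n) * b := by omega
    _ = 2 ^ (4 * n) * (b + 1) := by ring
    _ ≤ _ := Nat.mul_le_mul_left _ hb

/-- Digits add separately when nothing carries; a carry into position `i` could only come from
below. -/
theorem letter_add {a b : ℕ} : ∀ {i : ℕ}, (∀ j ≤ i, letter a j + letter b j < 16) →
    letter (a + b) i = letter a i + letter b i := by
  intro i
  induction i generalizing a b with
  | zero =>
    intro h
    have := h 0 le_rfl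
    simp only [letter_eq, pow_zero, Nat.div_one] at *
    omega
  | succ i ih =>
    intro h
    have h0 := h 0 (Nat.zero_le _)
    have step : ∀ x, letter x (i + 1) = letter (drop x 1) i := fun x => by
      rw [letter_drop, add_comm]
    have hd : drop (a + b) 1 = drop a 1 + drop b 1 := by
      simp only [letter_eq, pow_zero, Nat.div_one, drop_eq_div] at *
      omega
    rw [step, step, step, hd]
    refine ih fun j hj => ?_
    rw [letter_drop, letter_drop, add_comm 1]
    exact h (j + 1) (by omega)

theorem letter_xor (x y i : ℕ) : letter (x ^^^ y) i = letter x i ^^^ letter y i := by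
  refine Nat.eq_of_testBit_eq fun j => ?_
  simp only [letter, show 16 = 2 ^ 4 from rfl, Nat.testBit_mod_two_pow, Nat.testBit_shiftRight,
    Nat.testBit_xor]
  cases decide (j < 4) <;> simp

theorem exists_letter_ne_zero {x n : ℕ} (h : low x n ≠ 0) : ∃ i < n, letter x i ≠ 0 := by
  induction n generalizing x with
  | zero => simp [low_eq_mod, Nat.mod_one] at h
  | succ n ih =>
    by_cases h0 : letter x 0 = 0
    · obtain ⟨i, hi, hx⟩ := @ih (drop x 1) (by
        intro hc
        apply h
        rw [low_eq_mod] at hc ⊢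
        rw [drop_eq_div] at hc
        rw [letter_eq, pow_zero, Nat.div_one] at h0
        rw [show 4 * (n + 1) = 4 * 1 + 4 * n by ring, pow_add, Nat.mod_mul, hc]
        simpa using h0)
      exact ⟨i + 1, by omega, by rwa [letter_drop, add_comm] at hx⟩
    · exact ⟨0, by omega, h0⟩

theorem letter_eq_of_low_drop_eq {x a b n : ℕ} (h : low (drop x a) n = low (drop x b) n) {i : ℕ}
    (hi : i < n) : letter x (a + i) = letter x (b + i) := by
  rw [← letter_drop, ← letter_drop, ← letter_low hi, h, letter_low hi]

/-- The concatenation of blocks of `96` digits. -/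
def joinChunks : List ℕ → ℕ
  | [] => 0
  | c :: l => append c 96 (joinChunks l)

/-- The word of length `24 * 2 ^ k` and period `24` whose first `24` letters are those of `C`. -/
noncomputable def tile (C k : ℕ) : ℕ :=
  Nat.rec C (fun k t => append t (Nat.mul 24 (Nat.pow 2 k)) t) k

/-- The word of length `6 * 2 ^ k` that has the first `2 ^ k` letters of `x` at the positions
congruent to `3` modulo `6`, and the letter `0` elsewhere. -/
noncomputable def spread (k : ℕ) : ℕ → ℕ :=
  Nat.rec (fun x => Nat.shiftLeft (low x 1) 12)
    (fun k ih x => append (ih (low x (Nat.pow 2 k))) (Nat.mul 6 (Nat.pow 2 k))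
      (ih (drop x (Nat.pow 2 k)))) k

theorem tile_zero (C : ℕ) : tile C 0 = C := rfl

theorem tile_succ (C k : ℕ) : tile C (k + 1) = append (tile C k) (24 * 2 ^ k) (tile C k) := rfl

theorem spread_zero (x : ℕ) : spread 0 x = low x 1 <<< 12 := rfl

theorem spread_succ (k x : ℕ) : spread (k + 1) x =
    append (spread k (low x (2 ^ k))) (6 * 2 ^ k) (spread k (drop x (2 ^ k))) := rfl

theorem tile_lt {C : ℕ} (hC : C < 2 ^ (4 * 24)) (k : ℕ) : tile C k < 2 ^ (4 * (24 * 2 ^ k)) := by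
  induction k with
  | zero => simpa [tile_zero] using hC
  | succ k ih => rw [tile_succ, pow_succ, show 24 * (2 ^ k * 2) = 24 * 2 ^ k + 24 * 2 ^ k by ring]
                 exact append_lt ih ih

theorem letter_tile {C : ℕ} (hC : C < 2 ^ (4 * 24)) {k i : ℕ} (hi : i < 24 * 2 ^ k) :
    letter (tile C k) i = letter C (i % 24) := by
  induction k generalizing i with
  | zero => rw [tile_zero, Nat.mod_eq_of_lt (by simpa using hi)]
  | succ k ih =>
    rw [tile_succ, letter_append (tile_lt hC k)]
    split_ifs with h
    · exact ih h
    · rw [pow_succ] at hi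
      rw [ih (by omega)]
      congr 1
      omega

theorem spread_lt (k x : ℕ) : spread k x < 2 ^ (4 * (6 * 2 ^ k)) := by
  induction k generalizing x with
  | zero =>
    rw [spread_zero, low_eq_mod, Nat.shiftLeft_eq]
    norm_num
    omega
  | succ k ih =>
    rw [spread_succ, pow_succ, show 6 * (2 ^ k * 2) = 6 * 2 ^ k + 6 * 2 ^ k by ring]
    exact append_lt (ih _) (ih _)

theorem letter_spread {k x i : ℕ} (hi : i < 6 * 2 ^ k) :
    letter (spread k x) i = if i % 6 = 3 then letter x (i / 6) else 0 := by
  induction k generalizing x i with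
  | zero =>
    have h1 : letter x 0 < 16 := letter_lt x 0
    rw [spread_zero, Nat.shiftLeft_eq, ← Nat.mod_eq_of_lt (show low x 1 < 16 by
      rw [low_eq_mod]; omega)]
    have h2 : low x 1 % 16 = letter x 0 := by rw [low_eq_mod, letter_eq]; simp
    rw [h2]
    have h3 : i < 6 := by simpa using hi
    rw [Nat.div_eq_of_lt h3]
    generalize letter x 0 = y at *
    interval_cases i <;> simp [letter_eq] <;> omega
  | succ k ih =>
    rw [spread_succ, letter_append (spread_lt k _)]
    split_ifs with h h6 h6
    · rw [ih h, if_pos h6, letter_low (by omega)]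
    · rw [ih h, if_neg h6]
    · rw [pow_succ] at hi
      rw [ih (by omega), if_pos (by omega), letter_drop]
      congr 1
      omega
    · rw [pow_succ] at hi
      rw [ih (by omega), if_neg (by omega)]

/-- One carry-free addition interleaves a periodic background with a sparse sequence. The relation
`l = k + 2` makes the two lengths agree. -/
theorem letter_tile_add_spread {C x k l i : ℕ} (hC : C < 2 ^ (4 * 24)) (hl : l = k + 2)
    (hx : ∀ j < 2 ^ l, ∀ r < 24, r % 6 = 3 → letter C r + letter x j < 16)
    (hi : i < 6 * 2 ^ l) :
    letter (Nat.add (tile C k) (spread l x)) i =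
      letter C (i % 24) + if i % 6 = 3 then letter x (i / 6) else 0 := by
  have e : 6 * 2 ^ l = 24 * 2 ^ k := by rw [hl]; ring
  have ht : ∀ j, j ≤ i → letter (tile C k) j = letter C (j % 24) := fun j hj =>
    letter_tile hC (by omega)
  have hs : ∀ j, j ≤ i → letter (spread l x) j = if j % 6 = 3 then letter x (j / 6) else 0 :=
    fun j hj => letter_spread (by omega)
  rw [Nat.add_eq, letter_add, ht i le_rfl, hs i le_rfl]
  intro j hj
  rw [ht j hj, hs j hj]
  split_ifs with h
  · exact hx _ (by omega) _ (Nat.mod_lt _ (by norm_num)) (by omega)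
  · exact letter_lt _ _

/-! ### The data -/

/-- The first `6760` letters of the word, in blocks of `96` hexadecimal digits, least significant digit
first. -/
def prefixChunks : List ℕ :=
  [2636380110258614330941364861467345440081053731377063993289591867423864608005717772826312631272795120424825406947328,
   5099005496386528756892460818703169663576749735443885455122036047305962302656733619860067386608522770556171892891648,
   5099005496386528756892456744662299695034752441036127459330098392376558992050045039152520788972865353669147700039680,
   2645999740104281297845282296088967922068462262474310186604420080230487782025402426124599390842654958077165136064512,
   5099005496386528722716664169927738376714405142754659328668458380584036017570294009416702106163634209900600207941632,
   5099005497533278030711699925733148824350974712426212291166451059083680485780791997515633090386157295184665486897152,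
   2645999740104281332021072833787552905902723292310089907887903638064623714421883388787588755877349632530037192339456,
   5089386012751407240007957157233496782452862415888108573984492936670819226068863447245819426216539048833698037313536,
   10014636787300717141542837169813613912631816149388366736534938687867785094688987408181461315356351386888737487130624,
   5099005496386528722716664169927738378552604889818160257905661955617890658687511063849878593968480711463095526035456,
   2626760773407404305771978093134798435736488634262112009769249495910298388421475037443869571320840853122720310833152,
   2636380109685239711119637521263225198251593720661967655508030199747786343026843730358784460578743747280428840591360,
   2636380110258614365117157436201906756548727602724191264811910949354054205182615726125852857093880556132214143791104,
   2626760626623492848232130256517641446520661846233992472069571379621417760699397859001211615906383433460715730583552,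
   2645999887461567341032105823559469340384957946189797524008198982360823683708213620324984071735930785831316938104832,
   2645999886888192687034585908620787782080587057687536523177981609915056062243919268097093835456145792986043748786176,
   2645999886888192755386171058089910418721281544685256111218903071472541642387999950933108956802445851569643578273792,
   5108625127952310902610240180250649008704230696500203006411059292510820039305145665404789891496132264986910668173312,
   2636380110258614365117676880375629218741871267606577311336591182818905554304653028860512762640107707680267791568896,
   173829728418178407616857550798803497718926884169016609016472088394500412056155166663981905475511788753451777863680,
   173792152310228680015730817490643635610003818089747165621916805086415913872506187441374612346453509943889227747344,
   164247674682700878479952480584713107195475693572130133898214885536188073671350579284853703573219333591971938770992,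
   164210098001376497281807475676197218161652297259458831254939946494907938634842570269771089179589915442697371455536,
   183486935520784120416324332414645045051146931283812084173668523814675543217488513147855475564391346357001833746480,
   164210098003616241890484061062894176931798653052288339730734126020654687239633630532108104280878463545135469760528,
   173829728418178407616855529645846615304828715568174361066017111098319131359364244260065794751217620166485332791328,
   173829728418178407616855513731624466990211538636894056394954854633751149677306866991676940854203333381770394538000,
   164247674682700878479952488541884889752061967626886957673370173726930559013148106784536622892757199023989212647472,
   164210098001376497415304628385278712386812911967993047674670600643573917942496847628275393794204120172488890060832,
   164247674682700878613451670329769987345164550206042118884045556571152265628853357550909414060734519705612901748784,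
   164210098001376497281805438640222306521521571379532495659623425100638177764787551781021531231835443994108381696048,
   164247674682700878479952480584713107195475693140770961713661669700815405475429461122336980723480437807736997089328,
   164172521895666548598651113387309395706953372250948216600968420990176379242343401444210889472470247603271440076848,
   164247675258315277086151017946066535917360778891400580085103685063377183629096588011881875552496557726153868124192,
   164247675256075532343973205778337311080234330108188623050610648452260903857751688198491679317028647597852019728416,
   164210098003616276199777846664265613011689334725157898317807495109448895327238480894809215559204083198527658856496,
   164210098003616276199775825542633792200333641770327048072271821256567931485335857233571243348303080248864751554592,
   164247674682700878613451678286941769901750824692158089032311736659857531288583868556971092589183187753556330491936,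
   164247674684940623355629474540327429625704724499768163557596630645057420133871465939252179460683179565392043511840,
   183411782731510011483551367448138301230856904854938574180691852846497558025345183493274196951329110578696844021808,
   173867305103982244123565605276891456496732938072300601500739858149900606893147103812974867035934844754105406136336,
   164210098003616242023985279886754660442192471553184876129355217096416565936113929451473784501340998827126332395536,
   173867305103982244257066824100753362867556310288568797331212776770168074267252805582228580080550623413618421600304,
   173867305099502788948501761335394770405660474415839608794788367206680587401543431830029158741149648053807656013840,
   164210098003616241890484061062894176931798653052288339730734126020654687234231647310736400057000405896036769402896,
   173829728418178407616855529645846615304828715568174361066017111098319131359364244260065794751217620166485332791328,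
   173829728418178407616855513731624466990211538636894056394954854633751149677306866991676940854203333381770394538000,
   183411783302644989090476582652358353658389082528711369998460384892233418725480214612777061096243751361218993000496,
   183411782729270335092958704749653129847341358484234647134336477084104885065053338890703792772610285147922049871888,
   164172522469041168553873585178755995190404112529788301196943371233904591588693235165773642714784752701200712937488,
   164210098003616276199775825542633792200333641770327048072271821256567931485335857233571243272747522365959373402144,
   164247674684940623222130292752442332032602142353657119977019715303982073671171497287675777442608546829683040260128,
   173829728418178407616855513731745883795947377150790068514424364039217877999066199337252980470089293999442015359008,
   164247674682700878613451670329769987345164549774682972209633781374720152499071860544938925099923975096138926731280,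
   164247674684940657397922851572781502045512731037829175250075270474955556743677430261862303447651323802805738741808,
   173829728418178407483356323986567586847703149333589725440410975863095877352485432700760561732452028100006102765600,
   173829728422657896967711932407682471401603031884511575269315607238075843012192597297782848281599005028315385892912,
   164247674682700878613451670329769987345164549774682972209633781374720152499071860544938925099923975096070744117296,
   164247675258315311261943592680627854237708077600864471816999623096866236736759247128753896689135460210241366466608,
   173867305672877442679025333819938428626788253210638042680099737157322150468492093022243387587064168928840664551456,
   173867305099502788948501745421172622098252033510540134566131581689935804535229863225315129150250778053625272930320,
   173829728418178407483356323986567586847703149333589725440410975863095520540562256210790297160959670229890085490736,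
   164210098005856020808454424093790789218040680442304742576133192953579903946286952984535698129595869913968187346992,
   164210098001376497148306248895164952087463467820161337792191897184519179839634623635451187970735179155665802301472,
   173829728418178407483356323986689003646258520516878058018452246379094125132195466960839366923437856130112992383024,
   164285251364025259945097902019318616737602560695465505327565098030264667843473694280034344283898131395387437690896,
   164247674682700878746950860074827816063648438506237885932508914194116722691724801807163790762865280537637442097200,
   164210098003616276066276619883233346944709241738145391670486602165014221404678943760584009251097710621015859597360,
   164210098001376497148306248895164952087435198267124883642918564424507649955304560383071442638897595830229216071712,
   173829728418178407483356323986689003646258520516878058018452246379093768320272290470869102351945498259928524066864,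
   189132625495858805396320576370240305360906825744]

/-- The letters at the positions `6763 + 6 k` with `k < 20223`, in blocks of `96` hexadecimal digits,
least significant digit first. -/
def seedChunks : List ℕ :=
  [7717433511745872729727359961106990983407301117318055203944599545575806865272286943156259577598369694743319371989555,
   7716834633382925933010690477582547565607798792563442049688713995438452701757617513249918598100704761798197418009907,
   7717431163270482336481521363196015513164856496496516549370585494033134612498177251028906885247498178857857695491124,
   7716829936333736285265465678256109696798361113166172165757602979198224803912152395953562145569792325427222865388597,
   7716834633382925933010690477582555154158155515650455718729001992054426239573515427496259660517367185965417417024565,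
   7716829936333736285265465678753440492115734934196816389657251302221815691325577645463469293488633989341455486952244,
   7716829936333736285248778407350049344094817040020065625880616711385855446329151067352605377835854420090361565291572,
   7716832284840343159177462587604627569503759619505416868317068243737230917181714015624453632147562481019917051241524,
   7716829936333596301202392294586889503952283279126602435803128409211751977268933269439280591225089544119833931686709,
   7716834633418761848868848073548083023341240653807536827581139543755493767468692522660591966679646867651216533496884,
   7718032390171672439915504661420134622997969075483042100389168940876879160567202155779856539664148516917956468417588,
   7718032390171672437779517625499224540602947369367409879120765698109560420794880374038673751493001452337808508331060,
   7716832284840343159177462587604627569503759619505416868317068243737230917181714015644577589043518348365359027987508,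
   7717435860319811970400775739162198181857968304109121335935538237250421668291862842791824600334210976138312485577525,
   7716834633383205901103462703108867245892869848098207255375868326630309491404469821830080273470330269457353315328819,
   7716834633382925933010690478079870802017587201565889076226141520571790589547293880724215956282141558473908992222006,
   7716832284840483143215505001008721354637390139707527888877695386029655929628444676590394485921289948441550732272436,
   7717433511741393280709390253716065964430726224784322879813854999172691467816403539019662674746482533775051164099381,
   7716834633382925933002346778223481510598443239023822550639653781595396382131235350622557915563740843537473961337651,
   7717433511741393278565059517938774179166472033672328495254415509696068635118428927669260087878742274286498160452404,
   7716834633382925933010690477085224329198012150408059801548170257073383231724105585232583058252207536840851050341173,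
   7716834633383065919184719925912912548866783911737006439238197850142147944489393433339890769398940496135021987505205,
   7716834633383065919184719926907559021686357196047770935519285422653252501984443982213992529286931214360558457463604,
   7716834633382925933010690477582555154158155515650455718729001992054426239573515427496259660507922452999678126597173,
   7716829936333736285265465678753440492115734934196816389657251302221815691325577645463469293488633989341455486952244,
   7717433511741393278573403345607227639350419239699425270942517912852841019507817248183126270622474460388052586079284,
   7716832284840483143223848827682535930552126085025108227411497170505914949115162439927443491045911817085497844572979,
   7716832284840343159177462588101950805913546261633839169815569653468208857967391136489083524953341602656008934662965,
   7717431163234926386555118113885504118679393508788373071243707806194971857184257660839863420989645577172563290891060,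
   7716836981925508706852262066422210409954181721785821083247920074456572117886162434939425644872000052654525095486515,
   7716834633382925933002346778223481569883992928529819918192728619345451555657132059178011239399324972957872020398900,
   7716832284840483143223848827682535871266576395519216170543152941838683096748603318433287776399673692920584956158772,
   7716832284840483143215505001506044591047176781862910137018239028613754140145053071905524627395335624690203669701429,
   7717433511741393278573403218292479118445491160770153013351694215181108167902873859214778487605413389657751962133300,
   7717433511741393278573403217297840234175827587211947994309752824152072669047745273135504184236849996733707278492467,
   7716829936333596301219079565990280681615974251155419868586972664635592817146339763352227548135187479231884685353781,
   7716829936333596301202392294586889503952283279099747801421369129087424917628111459313930351860007964486346853196852,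
   7716832284840343159177462587604627569503759619505416868317068243737230917181714015624453632147562481301392027952180,
   7716832284840483143223848700367787409646293380398774746121719389711767770022660373305125249881252021828192701653814,
   7718032390135976503815071708155122348815867922600575776671361386166224900412786520856710695572274271259466095797045,
   7717435860283976054534274443340288609806104760678601988899624478933820893588932689556459062064448797718404854326323,
   7716829936333596301219079565990273093065613994401236589438899135264863745244624715932222659442443094780554554516531,
   7716829936333736287384765442276320542220623951812826379322628672049349245895560056559149193786935319208816231457844,
   7716834633418901832915234186311242863483774414727854652040387125679779877013020983639123675484847236706182159803444,
   7716834633418901832931921585029374973502485521807093654959321685020430085421539473964898681510429376919630113809204,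
   7716832284840483143223848827682535871266576395519216170543152941838683096748603318433287776399673692920584956158772,
   7717435860284256018363416424195910790168161635440177665618268944285598726834616894297413661688496702360697780183861,
   7717435860283976052406631107773075878139293145698132091334742418687880758905510058437901197854784141400709607334707,
   7716832284840483143215505001506044591047176781862910137018239028613754140145053071905445400437024813765848926921523,
   7717433511741393278573403218292479118445491160770153013351694215181108167902873859214778487605413389657751962133300,
   7717433511741393278573403217297840234175827587211947994309752824152072669047745273135504184236849996733707278492467,
   7716834633382925933002346778223481510598443239023822550639653781595396382131235350622557914364259613336345954624309,
   7718032390171812419689916703336113182620582377832448458640774413005525982620772566392592890199443901120664221918004,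
   7718032390171812423961890774680610110999932755471728503954949462440757875076912415228792064611794303576327302816819,
   7717433511741393278573403344612603872896827582200546313586698637841334589085991179502115359780298051515223046759475,
   7717433511741393278573403217297840234175827587211947994316029925887459349811581062558711850652952352178171313005363,
   7717433511741673246666175442824159914460895109079543589895398628543600719236098921355868239075365208055949488694069,
   7716834633383065919184719925912912548866783911737006440832581881744018628426366289051738228695104089750913058743093,
   7716834633383065917048732890986641350740976999944140375098901364642115749145697252781519574681398314096048598033204,
   7716832284840483143223848827682535871266576395519216170543152941838683096748603318433287776399673692920584956158772,
   7717435860284256018363416424195910790168161635440177665618268944285598726834616894297413661688496702360697780183861,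
   7717435860283976052406631107773075878139293145698132091334742418687880758905510058437901197854784141400709607334707,
   7717433511741393278573403344612596284346469092239507919488653220616835375284569000374789447579345792321429671387955,
   7717433511741393278573403217297840234175827587211947994309752824152072669047745273135504184236849996733707278492467,
   7716834633382925933002346778223481510598443239023822550639653781595396382131235350622557914364259613336345954624309,
   7716834633383065919184719925912912548866783911737006440832581881744024337417137112891341690001496080011458112529204,
   7716834633418901832915234185813919627073987772572472403899843387688854803836155568885070963662467768526268809749300,
   7716834633382925933002346778720804747008231648026269575570143263218032832692370590647983520657838576629575843980341,
   7716829936369572201131966846265962688635325823323552964629464054288293584456825836405998834661215847194615408108340,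
   7716832284840343159177462587604627569503759619505416868317068243737230917181714015644577587834592529032196240057397,
   7716832284840483143223848700367787409646296914119864249557529196101436270946711658946556145541708837521698897142581,
   7716832284840343159177462588101950805913546261633839169803015449997435496439719557642826648446165420442267953537845,
   7718034738642723361790142002167514535021919334185893898617105579590839189665753919734428278027663113847917873603382,
   7717435860319811968264788703738611335872733240094951469473377357477867108861429630284576562115716845590797202105139,
   7717435860283976052406631106778436993870080118141550874195451369593084209976365460400106571005352962025698208391987,
   7717433511741393278565059517938774179166920812880491473625093831728906692226698734961698769006022267786714759177013,
   7717433511741673246657831743465093859451539555539924089239400371189842962381175631279635803451062226211616340452149,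
   7716834633382925933010690477085224329198012150408059801548170257073383231724105585232583058252207536840851050341173,
   7716834633383065919184719925912912548866783911737006439238197850142147944489393433339890769398940496135021987505205,
   7716834633383065919184719926907559021686357196047770935519285422653252501984443982213992529286931214360558457463604,
   7716829936333736285265465678256109696798361113166172165757602979198224803912152395953562145569792325427222865388597,
   7716834633382925933010690477582555154158155515650455718729001992054426239573515427496259660517367185965417417024565,
   7718037087185166157984944886647681701758704989550900076235999693100879232352570233747288716871458760944695497597748,
   7718034738642583379871399224971552219803606455708649243066857194239250895153892517724031502399763483961117601047347,
   7717431163306318252348022785835365576456261460659405025345013870768869852098163679107111897314392908415138279859507,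
   7716829936333736285265465678256109696798361113166172165757602979198224803912152395953562145569792325427222865388597,
   7716836981961344622702075962531356576268481387361452813045602018556701060893048189069373569089775035698509416375349,
   7716832284840343159169118888245561544137178910691888761732314174063554972571306163612375554231401268832555189281589,
   7716829936333596301202392421404314758805102183969169738141119737776616561564240403795347812855208380272576624206645,
   7717433511741673244521844708538822661325732643747058023493165841430820469195115100672232917854705322960081291191349,
   7717435860319811970400775739162198181857968304109121335935538141469450408775298263228544357920479169569021526942515,
   7717435860283976052406631107773075878139293145698132091334742418687880758905510058437901197854784141400709607334707,
   7716834633383065919193063626266617488145354259653311988750666100093530313715675762237621418481848674552864055632691,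
   7716834633383065919184719925912912548866783911737006440832581881744018628426366289051738228695104089750913058743094,
   7716834633383065919184719926907559021686357196047770935519285422653252501984443982213992529286931214360558457463604,
   7716829936333736285265465678256109696798361113166172165757602979198224803912152395953562145569792325427222865388597,
   7716834633382925933010690477582555154158155515650455718729001992054426239573515427496259660517367185965417417024565,
   7718034738642583379871399224971552249445928987613012003511994898217618937737128074723225475949608768574686639563572,
   7716829936333596301219079565492949856655827352245854341298355396899794275211112787914887119593945869823212448261427,
   7716829936333736287384765569591069033483229498837735876474591575916163858736170793974006973347479237085924367148085,
   7716829936333736285248778407350049344094817040020065625880616711385855446329151067352605377835854420090361565291572,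
   7716832284840343159177462587604627569503759619505416868317068243737230917181714015624453632147562481019917051241524,
   7716829936333596301202392294586889503952283279126602435803128409211751977268933269439280591225089544119833931686709,
   7716834633383065917048732890489318114331190357788758125351419677799021554096357270493495201025452005275850483311668,
   7716834633418761848868848073050759786931454011652154579440595901171395623854319722937410477979992639886632031494965,
   7717435860319811970400775866476946702763350462734041638299064746598879877128494658520572508381962792312013135684405,
   7717435860283976052406631107773075878139293145698132091334742418687880758905510058437901197854784141400709607334707,
   7716832284840623127261891114269204431189712309630292739861816194209685389463863308897394160496111118609178402366259,
   7717433511741393278573403218292479118445491160770153013351694215181108167902873859214778487605413389657751962133300,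
   7716829936333596301202392294586897092502643535853825768284051203006842752265979954952740569826293880826297669788467,
   7716834633382925933010690477582555154158159049344585275497661158649427680809396967749524885701450414143186378302516,
   7716832284840343159169118888742884750904190708094219669147017193391966533296730823081546905765671976440181586797364,
   7717431163234646420615020195186162491685116941586189722070829358828486834746907718078454318096471775989307032085300,
   7716832284840623127261891114766527667599046638937302344602939882373882304564339222399484902769592049869435284104245,
   7716832284840483143215505001008721354636941360553284802240657304907426897950955796387065693205001269571018687652660,
   7716834633382925933010690477582555154158155515650455718729001992054431903963473760552387917675544647284243621356853,
   7716832284840343159177462587604627569503759619505416868317068243737230917181714015624453632152284775726667618460468,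
   7716829936333596301202392294586889503952283279126602435803128409211751977268933269439280591225089544119833931686709,
   7716834633418761848868848073548083023341240653807536827581139543755493767468692522660591966679646867651216533496884,
   7716832284840483143215505001008721354636937826859155245465721132358010013167737083228892814256949039983859553412148,
   7716834633418761848868848073050759786931454011652154579440595900797251204697608575877267160809346553337582945706805,
   7716834633418761848885535471768891896950165118731393582359530364356930086686987937908888116895011515409952516743989,
   7717435860284256018355072598019419421019985174676660903378864386871832010123735287936835304623208216194478216717109,
   7716834633382925933002346778223481510598443239023822549032715738084689280513756737198038311100240333492922452419379,
   7716834633383205901095119004247124427293299169866905224488638427814893845492959409664087289538094943666782163051318,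
   7718037087185166155840614150373066680085112935411122518792802742938891079379761069076636349247025085388262847161140,
   7716832284840483145351492036432315789172983693655776202764473558372776611030706027933560876011655895311160136835892,
   7716832284840483145351492037426962261992104665118168055633586877212240961055823794949390142518428249068567527564084,
   7716834633382925933010690477582555154158155515650455718729001992054431903963473760552387917675544647284243621356853,
   7716829936333736285265465678753440492115734934196816389657251302221815691325577645463469293488633989341455486952244,
   7717433511741393278565059517938781767716830523579446994411221411136156582712930612102874466167944689195642668590132,
   7716834633382925933002346778223489099148799962110836219679941873992352619745980702958021929785573954832644018677043,
   7716829936369572201131966846763293513595474489107143216957007437426457760086075025326119432990425047389468052562740,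
   7716832284840343159177462587604627569503759619505416868317068243737230917181714015644577587834592529032196240057396,
   7716829936333596301202392294586889503952283279126602435803128409211751977268933269439280591225089544119833931686709,
   7716834633418761848868848073548083023341240653807536827581139543755493767468692522660591966679646867651216533496884,
   7716832284840483143215505001008721354636937826859155245465721132358010013167737083228892814256949039983859553412148,
   7717435860319811970400775739162198181857968304109121335935538237250421712893351910625075098489774617065029575516981,
   7716832284840343159169118888245561514494856378787210064418447707950254141410501535849434834612681132078596496696115,
   7717433511741393280709390253716065964430727991631387658198184582470192188434174167972936408829722383014365927449397,
   7716834633382925933002346778223481510598443239023822550639653781595396382131235350622557915563740843537473961337651,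
   7718032390171672437787861070228793583443864671229037080864424604780837133550566024675604624881541865814506179011380,
   7716829936333596301219079565492949856655827352245854341298355396899794275211112787914887119593945869823212448261171,
   7716829936333736287384765569591069033483229498837735876474591575916163858736170793974006973347479237085924367148085,
   7716829936333736285248778407350049344094817040020065625880616711385855446329151067352605377835854420090361565291572,
   7716832284840343159177462587604627569503759619505416868317068243737230917181714015624453632147562481019917051241524,
   7716829936333596301202392294586889503952283279126602435803128409211751977268933269439280591225089544119833931686709,
   7716834633418761848868848073548083023341240653807536827581139543755493767468692522660591966679646867651216533496884,
   7716834633383065917048732890489318114331190357788758126958357721309728700315666563346182027033297024075108003750964,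
   7717435860283976052398287407419378527411083054509049875910135102571550788938118175763578751539172937491859814622005,
   7716829936333596301219079565492949827013052507492908312864183235049834283930707860571046042668172816829369991439411,
   7716829936333596301202392294089566267542496636944365553280825390722355447594599531296594813220436558580683968226357,
   7716829936333596301202392294586897033217994938377930634078390892388877755212156888359308091168521274324896998106165,
   7716834633418761848868848074045406259751027295962919075727960383855949918266040240101055943572806364663749909029940,
   7716832284840483143215505001008721354636937826859155245465721132358010013167737083228892814256949039983859553412148,
   7716834633418761848868848073050759786931454011652154579440595900797251204697608575877267160809346553337582945706805,
   7716834633418761848885535471768891896950165118731393582359530364356930086686987937908888116895011515409952516743989,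
   7717435860284256018355072598019419421019985174676660903378864386871832010123735287936835304623208216194478216717109,
   7717435860319811970400775739162198181857968304109121337542476186102585103473971502629850277613328249900863448032051,
   7717435860283976052406631107773075878139293145698132091334742418687880758905510058437901197854784141400709607334707,
   7716834633382925933002346778223481510598443239023822550639653781595396382131235350622557915563740843537478256304947,
   7717433511741393278565059517938774179166472033672328495254415509696068635118428927669260087878742274286498160452404,
   7716834633418901835051221221237514061609581326520720717774067643529971572307047680232847699240498322652317115097909,
   7716834633418901832931921585029374973502485521807093654959321685020430085421539473964898681510429376919630113809204,
   7716832284840483143223848700367787409646745693247252701825362200570111604511050307870950031725120575590077927924532,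
   7716834633383065917048732890489318114331190357788758126958357625528757440798763030643897401700534663034693486781237,
   7717433511741393278565059517938781767716830523579446996024436557504683667166209135559119681941316058748917970510645,
   7716834633382925933010690477085224329198012150408059801548170257073383231724105585232583058252207536840855311754547,
   7716834633383065919184719925912912548866783911737006439238197850142147944489393433339890769398940496135021987505205,
   7718638314086636223103739048005893232523381720245332525179988622119389238515732001498572650117690716724486983525172,
   7717433511741393278565059772568278750242944476533077013459189486290750939690077740778512071945696232611602633990963,
   7717431163270482336481521617825520113883655004901837494662454239956400289553383777849282066333362536516339240149811,
   7716834633382925933010690477085224329198012150408059801548170257073383231724105585232583058252207536840855311754803,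
   7716834633382925933010690477582555154158155515650455718729001992054431903963473760572670327279196317989665849353269,
   7716829936333736285265465678753440492115734934196816389657251302221815691325577645463469293488633989341455486952244,
   7717431163234646420598332924777417757199130801578436919222009267056114231583429907717373233999789000881257371018292,
   7717435860283976052398287407419370938860724564601931373539453112239326453121442170323874135381049980181365060150323,
   7716832284840483145351492036432315789172983693655776202764473558372776611030706027933560876011655895311164431803189,
   7716832284840343159169118888742892339454547431181233338187305189259656941789971950135142428516187129864682421232437,
   7716829936369572201131966846763293543238249333860089245391179599276417751366479952669960509920920466866180154598196,
   7716832284840343159177462587604627569503759619505416868317068243737230917181714015644577587834592529032196240057396,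
   7716829936333596301202392294586889503952283279126602435803128409211751977268933269439280591225089544119833931686709,
   7716834633418761848868848073548083023341240653807536827581139543755493767468692522660591966679646867651216533496884,
   7716832284840483143215505001008721354636937826859155245465721132358010013167737083228892814256949039983859553412148,
   7716834633418761848868848073050759786931454011652154579440595900797251204697608575877267160809346553337582945706805,
   7716834633418761848885535471768891896950165118731393582359530364356930086686987937908888116895011515409952516743989,
   7717435860284256018355072598019419421019985174676660903378864386871832010123735287936835304623208216194478216717109,
   7717431163234646420598333051097535012027526874816739738781231133346078937044535807323631401323758486419257885336371,
   7718032390207508353654362492868151235285629892146214145064718884149186218043917649411443050381716239004360264262707,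
   7716834633382925933010690477582555154158155515650455718729001992054431903963473760572670327279196317708190872642612,
   7717431163234926386571805385786218562394743108929336919544152368710527936836006985224996000432220490129431662306100,
   7717433511741393278565059518933413063435685061228909710793045615893111461121966581097066375461978266321979533567027,
   7717433511741393278573403344612588695796110602332389418724909274543601315009852428840538273715331763379669225841459,
   7716832284840483145359835735791381844181886934347023060008497562054888451424924383063718390596060434901086784070453,
   7716832284840483145359835736786028317001460218657787556289585134565998717910747085025622578142731230912900675806004,
   7716834633382925933010690477582555154158155515650455718729001992054431903963473760552387917675544647284243621356853,
   7716829936333596301202392421901645583765249082905695212090610638978522300483587475427965611119548900618159893127988,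
   7716832284840483143223848700367787409646293380398774746121719389711767770022660373325407659475459102838647358104628,
   7718032390135976503815071708155122348815867922600575776671361386166224900412786520856710695572274271259466095797045,
   7717435860284256018355072598019419421019985174676660903378864386871832010123735287936835304623208216194478216717363,
   7716832284840483143223848827682535871266576395519216170543152846805989257563920714539241486964796100824042024608563,
   7717435860284256018363416424195910790168161635440177665618268944285598726834616894297413661688496702360697780183861,
   7717435860283976052406631107773075878139293145698132091334742418687880758905510058437901197854784141400709607334707,
   7716834633383205901103462703606190482302656490253589503528966268466152322965653328693593459245637774468959392899891,
   7718037087185306135623369891150780469756030266720165639712579075083689459737292914789628310961612185806852170326836,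
   7716832284840483143215505001506044591047176781862910137018239028613754140145390695856781131951017192368917595693875,
   7716836981925648690890304479826304195087359929166308782467832285027849053676915399721217798580880053526934635815732,
   7717435860319811968264788703738611335872733240094951469473377357477867108861428301056660002944506567173538536629044,
   7716834633383065917057076590843030642160122729333271679069718686167721816565358919185541574805509590950356233364275,
   7718037087185306135623369891150780469756028499873100861328249491786188739119522285836354576878372336849012383687476,
   1873093928383130134451589932329839560894171929575481265459473964668251415347]

/-- The number whose digits are the first `6760` letters of the word. -/
def prefixWord : ℕ := joinChunks prefixChunks

/-- The number whose digits are the letters at the positions `6763 + 6 k` with `k < 20223`. -/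
def seedWord : ℕ := joinChunks seedChunks

/-- The number whose digits are the first letters of the word. -/
noncomputable def longPrefix : ℕ :=
  -- The period has 0 at the offsets congruent to 3 modulo 6, where the seed letters are added; `24
  -- * 2 ^ 11 = 6 * 2 ^ 13`.
  append prefixWord 6760 (Nat.add (tile 0x110100100101100001110000 11) (spread 13 seedWord))

/-- The number whose digits are the first letters of the subsequence at the positions
`6763 + 6 k`. -/
noncomputable def longSeed : ℕ :=
  -- This period is the columns plus the increments. At offsets congruent to 3 modulo 6 it is the
  -- bare increment 2, to which seed letters are added.
  append seedWord 20223 (Nat.add (tile 0x322223332222332322322323 12) (spread 14 seedWord))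

/-! ### Checking conditions on finite words by evaluation -/

/-- Whether `p` holds at the `2 ^ k` numbers from `lo` on. -/
noncomputable def forallRange (p : ℕ → Bool) (k : ℕ) : ℕ → Bool :=
  -- Halving the range keeps the recursion depth at `k` during kernel evaluation.
  Nat.rec (fun lo => p lo) (fun k ih lo => cond (ih lo) (ih (Nat.add lo (Nat.pow 2 k))) false) k

/-- Whether `p` holds at the numbers below `n`. -/
noncomputable def forallLt (p : ℕ → Bool) (n : ℕ) : Bool :=
  Nat.rec true (fun i ih => cond (p i) ih false) n

theorem forallRange_spec {p : ℕ → Bool} {k lo : ℕ} (h : forallRange p k lo = true) {j : ℕ}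
    (h1 : lo ≤ j) (h2 : j < lo + 2 ^ k) : p j = true := by
  induction k generalizing lo with
  | zero =>
    obtain rfl : j = lo := by simp at h2; omega
    exact h
  | succ k ih =>
    change cond (forallRange p k lo) (forallRange p k (lo + 2 ^ k)) false = true at h
    cases hc : forallRange p k lo with
    | false => simp [hc] at h
    | true =>
      rw [hc, cond_true] at h
      rw [pow_succ] at h2
      rcases lt_or_ge j (lo + 2 ^ k) with h3 | h3
      · exact ih hc h1 h3
      · exact ih h h3 (by omega)

theorem forallLt_spec {p : ℕ → Bool} {n : ℕ} (h : forallLt p n = true) {j : ℕ} (hj : j < n) :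
    p j = true := by
  induction n with
  | zero => omega
  | succ n ih =>
    change cond (p n) (forallLt p n) false = true at h
    cases hc : p n with
    | false => simp [hc] at h
    | true =>
      rw [hc, cond_true] at h
      rcases Nat.lt_succ_iff_lt_or_eq.mp hj with h3 | rfl
      · exact ih h h3
      · exact hc

/-- Whether none of the `n` windows of length `l` of `E` that start at the positions below `n`
consists of zeros only. To advance quickly, nonzero letters are sought among the last `g` letters of
the current window, then among its last `h` letters, and then in the whole window. -/
noncomputable def scan (l g h fuel : ℕ) : ℕ → ℕ → Bool :=
  -- Running out of fuel counts as failure unless no window is left.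
  Nat.rec (fun n _ => Nat.beq n 0)
    (fun _ ih n E => cond (Nat.beq n 0) true
      (cond (Nat.beq (low (drop E (Nat.sub l g)) g) 0)
        (cond (Nat.beq (low (drop E (Nat.sub l h)) h) 0)
          (cond (Nat.beq (low E l) 0) false (ih (Nat.sub n 1) (drop E 1)))
          (ih (Nat.sub n (Nat.add (Nat.sub l h) 1)) (drop E (Nat.add (Nat.sub l h) 1))))
        (ih (Nat.sub n (Nat.add (Nat.sub l g) 1)) (drop E (Nat.add (Nat.sub l g) 1))))) fuel

theorem scan_succ (l g h fuel n E : ℕ) : scan l g h (fuel + 1) n E =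
    cond (n.beq 0) true
      (cond ((low (drop E (l - g)) g).beq 0)
        (cond ((low (drop E (l - h)) h).beq 0)
          (cond ((low E l).beq 0) false (scan l g h fuel (n - 1) (drop E 1)))
          (scan l g h fuel (n - (l - h + 1)) (drop E (l - h + 1))))
        (scan l g h fuel (n - (l - g + 1)) (drop E (l - g + 1)))) := rfl

/-- A nonzero letter among the last `g` of the first window lies in every window starting at most `l
- g` later, so the scan may skip `l - g + 1` starts. -/
theorem exists_letter_ne_zero_of_window {l g n E : ℕ} (hg : g ≤ l)
    (hne : low (drop E (l - g)) g ≠ 0)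
    (ih : ∀ u < n - (l - g + 1), ∃ i < l, letter (drop E (l - g + 1)) (u + i) ≠ 0)
    {u : ℕ} (hu : u < n) : ∃ i < l, letter E (u + i) ≠ 0 := by
  rcases lt_or_ge u (l - g + 1) with h | h
  · obtain ⟨i, hi, hx⟩ := exists_letter_ne_zero hne
    rw [letter_drop] at hx
    exact ⟨l - g + i - u, by omega, by rwa [show u + (l - g + i - u) = l - g + i by omega]⟩
  · obtain ⟨i, hi, hx⟩ := ih (u - (l - g + 1)) (by omega)
    rw [letter_drop] at hx
    exact ⟨i, hi, by rwa [show l - g + 1 + (u - (l - g + 1) + i) = u + i by omega] at hx⟩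

theorem scan_spec {l g h fuel n E : ℕ} (hg : g ≤ l) (hh : h ≤ l)
    (hs : scan l g h fuel n E = true) {u : ℕ} (hu : u < n) : ∃ i < l, letter E (u + i) ≠ 0 := by
  induction fuel generalizing n E u with
  | zero =>
    have : n = 0 := Nat.eq_of_beq_eq_true hs
    omega
  | succ fuel ih =>
    rw [scan_succ] at hs
    cases h0 : n.beq 0 with
    | true =>
      have := Nat.eq_of_beq_eq_true h0
      omega
    | false =>
      rw [h0, cond_false] at hs
      cases h1 : (low (drop E (l - g)) g).beq 0 with
      | false =>
        rw [h1, cond_false] at hs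
        exact exists_letter_ne_zero_of_window hg (Nat.ne_of_beq_eq_false h1)
          (fun u hu => ih hs hu) hu
      | true =>
        rw [h1, cond_true] at hs
        cases h2 : (low (drop E (l - h)) h).beq 0 with
        | false =>
          rw [h2, cond_false] at hs
          exact exists_letter_ne_zero_of_window hh (Nat.ne_of_beq_eq_false h2)
            (fun u hu => ih hs hu) hu
        | true =>
          rw [h2, cond_true] at hs
          cases h3 : (low E l).beq 0 with
          | true => simp [h3] at hs
          | false =>
            rw [h3, cond_false] at hs
            have hd : drop E 0 = E := by simp [drop_eq_div]
            refine exists_letter_ne_zero_of_window (g := l) le_rfl ?_ (fun u hu => ?_) hu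
            · rw [Nat.sub_self, hd]
              exact Nat.ne_of_beq_eq_false h3
            · rw [Nat.sub_self, zero_add] at hu ⊢
              exact ih hs hu

/-- `scan` with the window sizes used throughout. -/
noncomputable def scanWindows (l n E : ℕ) : Bool :=
  scan l (Nat.add (Nat.div l 8) 1) (Nat.add (Nat.div l 2) 1) 1000 n E

theorem scanWindows_spec {l n E : ℕ} (hl : 0 < l) (hs : scanWindows l n E = true) {u : ℕ}
    (hu : u < n) : ∃ i < l, letter E (u + i) ≠ 0 :=
  scan_spec (by change l / 8 + 1 ≤ l; omega) (by change l / 2 + 1 ≤ l; omega) hs hu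

/-- The number whose nonzero digits are at the positions below `M` where `X` differs from its
shift by `4 * l`. -/
noncomputable def mismatches (X M l : ℕ) : ℕ :=
  Nat.xor (low X M) (low (drop X (Nat.mul 4 l)) M)

theorem ne_of_letter_mismatches_ne_zero {X M l i : ℕ} (h : letter (mismatches X M l) i ≠ 0) :
    letter X i ≠ letter X (i + 4 * l) := by
  intro he
  apply h
  change letter (low X M ^^^ low (drop X (4 * l)) M) i = 0
  rw [letter_xor]
  rcases lt_or_ge i M with hi | hi
  · rw [letter_low hi, letter_low hi, letter_drop, he, add_comm, Nat.xor_self]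
  · rw [letter_low_of_le hi, letter_low_of_le hi]
    rfl

/-- Whether `X` has no factor `x y x` with `|x| = l` and `|y| = 3 * l` that starts at a position
below `M - l`, if `128 ≤ l`, and below `w * 2 ^ k`, if `l < 128`. -/
noncomputable def avoids (X M w k l : ℕ) : Bool :=
  -- For short `l` a scan advances slowly, so the starts are cut into blocks of `w`, each needing at
  -- most `w` steps of fuel.
  cond (Nat.ble 128 l)
    (scanWindows l (Nat.sub M l) (mismatches X M l))
    (cond (Nat.beq l 0) true
      (forallRange (fun j => scanWindows l w
        (low (drop (mismatches X M l) (Nat.mul w j)) (Nat.add w l))) k 0))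

theorem avoids_spec {X M w k l : ℕ} (h : avoids X M w k l = true) (hl : 0 < l) {s : ℕ}
    (hs : s + l < M) (hk : s < w * 2 ^ k) :
    ∃ i < l, letter X (s + i) ≠ letter X (s + i + 4 * l) := by
  rw [avoids] at h
  cases h1 : Nat.ble 128 l with
  | true =>
    rw [h1, cond_true] at h
    obtain ⟨i, hi, hx⟩ := scanWindows_spec hl h (show s < M - l by omega)
    exact ⟨i, hi, ne_of_letter_mismatches_ne_zero hx⟩
  | false =>
    rw [h1, cond_false] at h
    cases h2 : Nat.beq l 0 with
    | true =>
      have := Nat.eq_of_beq_eq_true h2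
      omega
    | false =>
      rw [h2, cond_false] at h
      have hw : 0 < w := Nat.pos_of_ne_zero fun h => by simp [h] at hk
      have hj := forallRange_spec h (Nat.zero_le (s / w))
        (by rw [zero_add]; exact Nat.div_lt_of_lt_mul hk)
      obtain ⟨i, hi, hx⟩ := scanWindows_spec hl hj (Nat.mod_lt s hw)
      have hm : s % w < w := Nat.mod_lt s hw
      change letter (low (drop _ (w * (s / w))) (w + l)) _ ≠ 0 at hx
      rw [letter_low (show s % w + i < w + l by omega), letter_drop] at hx
      refine ⟨i, hi, ne_of_letter_mismatches_ne_zero (M := M) ?_⟩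
      rwa [← add_assoc, Nat.div_add_mod] at hx

/-- Whether the factor of `Y` with `|x| = l` that ends at position `i` becomes a `5/4`-power when
the letter at position `i` is replaced by `c`; with `e = 0` or `e = 1`, only factors starting at a
position at least `1 - e` count. -/
noncomputable def bannedBy (Y e i c l : ℕ) : Bool :=
  cond (Nat.ble (Nat.mul 5 l) (Nat.add i e))
    (cond (Nat.beq (low (drop Y (Nat.sub i (Nat.mul 4 l))) 1) c)
      (Nat.beq (low (drop Y (Nat.sub (Nat.add i 1) l)) (Nat.sub l 1))
        (low (drop Y (Nat.sub (Nat.add i 1) (Nat.mul 5 l))) (Nat.sub l 1))) false) false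

/-- Lengths that suffice to rule out all letters smaller than the given ones. -/
def lengths : List ℕ :=
  [1, 2, 6, 12, 24, 18, 36, 30, 66, 138, 120, 114, 3, 5, 42, 60, 84, 96, 100, 132, 144, 150, 156,
    180, 186, 210, 222, 244, 246, 276, 282, 288, 294, 300, 336, 342, 360, 366, 408, 420, 450, 952,
    1020]

/-- Whether the letter of `Y` at position `i` is between `cm` and `13`, and all smaller letters
that are at least `cm` are ruled out. -/
noncomputable def minimalAt (Y e cm i : ℕ) : Bool :=
  -- The bound 13 leaves room to add an increment of 2 within one hexadecimal digit.
  cond (Nat.ble cm (low (drop Y i) 1)) (cond (Nat.ble (low (drop Y i) 1) 13)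
    (forallLt (fun c => cond (Nat.ble cm c) (lengths.any (bannedBy Y e i c)) true)
      (low (drop Y i) 1)) false) false

/-- `minimalAt` at the positions `i` with `lo ≤ i` and `w * j ≤ i < w * (j + 1)`. -/
noncomputable def minimalOn (X e cm lo w j : ℕ) : Bool :=
  -- The cut-out holds up to 128 positions to test and 5120 letters of history; the longest factor
  -- considered has `5 * 1020` letters.
  (fun a => (fun Y => forallLt (fun r => cond (Nat.ble lo (Nat.add (Nat.mul w j) r))
      (minimalAt Y e cm (Nat.sub (Nat.add (Nat.mul w j) r) a)) true) w)
    (low (drop X a) 5248)) (Nat.sub (Nat.mul w j) 5120)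

/-- The condition that `X` has a factor `x y x'` starting at `s` with `|x| = |x'| = l > 0` and
`|y| = 3 * l` such that `x` ends with `c` and differs from `x'` at most in the last letter. -/
def Bans (X : ℕ → ℕ) (s l c : ℕ) : Prop :=
  0 < l ∧ X (s + l - 1) = c ∧ ∀ i, i + 1 < l → X (s + i) = X (s + i + 4 * l)

theorem bannedBy_spec {Y e i c l : ℕ} (he : e ≤ 1) (h : bannedBy Y e i c l = true) (hl : 0 < l) :
    ∃ s, 1 ≤ s + e ∧ s + 5 * l = i + 1 ∧ Bans (letter Y) s l c := by
  rw [bannedBy] at h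
  cases h1 : Nat.ble (Nat.mul 5 l) (Nat.add i e) with
  | false => rw [h1] at h; cases h
  | true =>
    have hle : 5 * l ≤ i + e := Nat.le_of_ble_eq_true h1
    rw [h1, cond_true] at h
    cases h2 : Nat.beq (low (drop Y (Nat.sub i (Nat.mul 4 l))) 1) c with
    | false => rw [h2] at h; cases h
    | true =>
      have hc : low (drop Y (i - 4 * l)) 1 = c := Nat.eq_of_beq_eq_true h2
      rw [h2, cond_true] at h
      have h3 : low (drop Y (i + 1 - l)) (l - 1) = low (drop Y (i + 1 - 5 * l)) (l - 1) :=
        Nat.eq_of_beq_eq_true h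
      refine ⟨i + 1 - 5 * l, by omega, by omega, hl, ?_, fun k hk => ?_⟩
      · rw [← hc, show i + 1 - 5 * l + l - 1 = i - 4 * l by omega, ← Nat.add_zero (i - 4 * l),
          ← letter_drop, Nat.add_zero, letter_eq, low_eq_mod]
        simp
      · rw [← letter_eq_of_low_drop_eq h3 (show k < l - 1 by omega)]
        congr 1
        omega

theorem minimalAt_spec {Y e cm i : ℕ} (he : e ≤ 1) (h : minimalAt Y e cm i = true) :
    cm ≤ letter Y i ∧ letter Y i ≤ 13 ∧ ∀ c, cm ≤ c → c < letter Y i →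
      ∃ s l, 1 ≤ s + e ∧ s + 5 * l = i + 1 ∧ Bans (letter Y) s l c := by
  have hx : low (drop Y i) 1 = letter Y i := by
    rw [← Nat.add_zero i, ← letter_drop, Nat.add_zero, letter_eq, low_eq_mod]
    simp
  rw [minimalAt, hx] at h
  cases h1 : Nat.ble cm (letter Y i) with
  | false => simp [h1] at h
  | true =>
    rw [h1, cond_true] at h
    cases h2 : Nat.ble (letter Y i) 13 with
    | false => simp [h2] at h
    | true =>
      rw [h2, cond_true] at h
      refine ⟨Nat.le_of_ble_eq_true h1, Nat.le_of_ble_eq_true h2, fun c hc hlt => ?_⟩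
      have h3 := forallLt_spec h hlt
      rw [Nat.ble_eq_true_of_le hc, cond_true, List.any_eq_true] at h3
      obtain ⟨l, hl, hb⟩ := h3
      have hpos : ∀ l ∈ lengths, 0 < l := by decide
      obtain ⟨s, hs⟩ := bannedBy_spec he hb (hpos l hl)
      exact ⟨s, l, hs⟩

theorem minimalOn_spec {X e cm lo w j n : ℕ} (he : e ≤ 1) (hw : w ≤ 128)
    (h : minimalOn X e cm lo w j = true) (hlo : lo ≤ n) (h1 : w * j ≤ n) (h2 : n < w * j + w) :
    cm ≤ letter X n ∧ letter X n ≤ 13 ∧ ∀ c, cm ≤ c → c < letter X n →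
      ∃ s l, 1 ≤ s + e ∧ s + 5 * l = n + 1 ∧ Bans (letter X) s l c := by
  have h3 := forallLt_spec h (show n - w * j < w by omega)
  change cond (Nat.ble lo (w * j + (n - w * j))) (minimalAt (low (drop X (w * j - 5120)) 5248) e cm
    (w * j + (n - w * j) - (w * j - 5120))) true = true at h3
  rw [show w * j + (n - w * j) = n by omega, Nat.ble_eq_true_of_le hlo, cond_true] at h3
  obtain ⟨a, ha⟩ : ∃ a, a = w * j - 5120 := ⟨_, rfl⟩
  rw [← ha] at h3
  have hY : ∀ i < 5248, letter (low (drop X a) 5248) i = letter X (a + i) := fun i hi => by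
    rw [letter_low hi, letter_drop]
  obtain ⟨g1, g2, g3⟩ := minimalAt_spec he h3
  rw [hY _ (by omega), show a + (n - a) = n by omega] at g1 g2 g3
  refine ⟨g1, g2, fun c hc hlt => ?_⟩
  obtain ⟨s, l, hs, hsl, hl, hb, hm⟩ := g3 c hc hlt
  refine ⟨a + s, l, by omega, by omega, hl, ?_, fun i hi => ?_⟩
  · rw [← hb, hY _ (by omega)]
    congr 1
    omega
  · have := hm i hi
    rw [hY _ (by omega), hY _ (by omega)] at this
    rw [add_assoc a, this]
    congr 1
    omega

/-! ### The finite verifications -/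

theorem avoids_longPrefix_lower :
    forallRange (avoids longPrefix 6912 106 6) 12 0 = true := by decide +kernel

theorem avoids_longPrefix_upper :
    forallRange (avoids longPrefix 6912 106 6) 12 4096 = true := by decide +kernel

theorem avoids_longSeed_first :
    forallRange (avoids longSeed 20736 160 7) 12 0 = true := by decide +kernel

theorem avoids_longSeed_second :
    forallRange (avoids longSeed 20736 160 7) 12 4096 = true := by decide +kernel

theorem avoids_longSeed_third :
    forallRange (avoids longSeed 20736 160 7) 12 8192 = true := by decide +kernel

theorem avoids_longSeed_fourth :
    forallRange (avoids longSeed 20736 160 7) 12 12288 = true := by decide +kernel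

theorem avoids_longSeed_fifth :
    forallRange (avoids longSeed 20736 160 7) 12 16384 = true := by decide +kernel

/-- Base case of minimality for the word, up to position `107 * 2 ^ 6 = 6848`. -/
theorem minimalOn_longPrefix :
    forallRange (minimalOn longPrefix 1 0 0 107) 6 0 = true := by decide +kernel

/-- Base case for `core`, up to index `80 * 2 ^ 8 = 20480`. Starts must be at least 1 so that the
powers can be inflated by `Bans.word_of_core`; the exempted first nine letters lie in the range of
`minimalOn_longPrefix`. -/
theorem minimalOn_longSeed :
    forallRange (minimalOn longSeed 0 2 9 80) 8 0 = true := by decide +kernel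

theorem prefixWord_lt : prefixWord < 2 ^ (4 * 6760) := by decide +kernel

theorem seedWord_lt : seedWord < 2 ^ (4 * 20223) := by decide +kernel

theorem letter_seedWord_of_lt_nine : ∀ t < 9, 2 ≤ letter seedWord t ∧ letter seedWord t ≤ 13 := by
  decide +kernel

/-- This letter and the last one of `seedWord` are too large to recur `4 * l` places later when `6 ∣
l`, which stops long repetitions from crossing the boundary. -/
theorem letter_prefixWord_last : letter prefixWord 6759 = 2 := by decide +kernel

theorem letter_seedWord_last : letter seedWord 20222 = 4 := by decide +kernel

/-! ### The word -/

/-- The letter at position `6760 + m` if `m` is not congruent to `3` modulo `6`. -/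
def column (m : ℕ) : ℕ := letter 0x110100100101100001110000 (m % 24)

/-- The amount by which the last letter of the image of a letter exceeds that letter, for the
subscript `m`. -/
def increment (m : ℕ) : ℕ := letter 0x21212323 (m % 8)

/-- The lexicographically least `5/4`-power-free word. -/
def word (n : ℕ) : ℕ :=
  if n < 6760 then letter prefixWord n
  else if (n - 6760) % 6 ≠ 3 then column (n - 6760)
  else if h : (n - 6760) / 6 < 20223 then letter seedWord ((n - 6760) / 6)
  else word (6760 + ((n - 6760) / 6 - 20223)) + increment ((n - 6760) / 6 - 20223)
termination_by n
decreasing_by omega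

/-- The subsequence of `word` at the positions that are not in constant columns. -/
def core (t : ℕ) : ℕ := word (6763 + 6 * t)

theorem word_of_lt {n : ℕ} (h : n < 6760) : word n = letter prefixWord n := by
  rw [word, if_pos h]

theorem word_of_ne {m : ℕ} (h : m % 6 ≠ 3) : word (6760 + m) = column m := by
  rw [word, if_neg (by omega), if_pos (by rwa [Nat.add_sub_cancel_left]), Nat.add_sub_cancel_left]

theorem word_of_eq {m : ℕ} (h : m % 6 = 3) : word (6760 + m) = core (m / 6) := by
  rw [core]
  congr 1
  omega

theorem core_of_lt {t : ℕ} (h : t < 20223) : core t = letter seedWord t := by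
  have e : (6763 + 6 * t - 6760) / 6 = t := by omega
  rw [core, word, if_neg (by omega), if_neg (by omega), dif_pos (by rwa [e]), e]

theorem core_add (m : ℕ) : core (20223 + m) = word (6760 + m) + increment m := by
  have e : (6763 + 6 * (20223 + m) - 6760) / 6 = 20223 + m := by omega
  rw [core, word, if_neg (by omega), if_neg (by omega), dif_neg (by rw [e]; omega), e,
    Nat.add_sub_cancel_left]

theorem increment_of_odd {m : ℕ} (h : m % 2 = 1) : increment m = 2 := by
  have key : ∀ r < 8, r % 2 = 1 → letter 0x21212323 r = 2 := by decide
  exact key _ (Nat.mod_lt _ (by norm_num)) (by omega)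

theorem increment_congr {m n : ℕ} (h : m % 8 = n % 8) : increment m = increment n := by
  rw [increment, increment, h]

theorem column_congr {m n : ℕ} (h : m % 24 = n % 24) : column m = column n := by
  rw [column, column, h]

theorem column_le_one (m : ℕ) : column m ≤ 1 := by
  have key : ∀ r < 24, letter 0x110100100101100001110000 r ≤ 1 := by decide
  exact key _ (Nat.mod_lt _ (by norm_num))

/-- At even offsets column plus increment depends on `m` modulo 8 only, and switches between 3 and 2
under a shift by 4. -/
theorem core_add_of_even {m : ℕ} (h : m % 2 = 0) :
    core (20223 + m) = if m % 8 < 4 then 3 else 2 := by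
  have key : ∀ r < 24, r % 2 = 0 →
      letter 0x110100100101100001110000 r + letter 0x21212323 (r % 8) =
        if r % 8 < 4 then 3 else 2 := by decide
  have := key (m % 24) (Nat.mod_lt _ (by norm_num)) (by omega)
  rw [core_add, word_of_ne (by omega), column, increment]
  rwa [Nat.mod_mod_of_dvd m (by norm_num : 8 ∣ 24)] at this

theorem minimal_longSeed {t : ℕ} (h1 : 9 ≤ t) (h2 : t < 20480) :
    2 ≤ letter longSeed t ∧ letter longSeed t ≤ 13 ∧ ∀ c, 2 ≤ c → c < letter longSeed t →
      ∃ s l, 1 ≤ s ∧ s + 5 * l = t + 1 ∧ Bans (letter longSeed) s l c :=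
  minimalOn_spec (j := t / 80) (by norm_num) (by norm_num)
    (forallRange_spec minimalOn_longSeed (Nat.zero_le _) (by omega)) h1 (by omega) (by omega)

/-- The minimality check speaks of raw digits of `longSeed`, so these bounds are available before
`core_eq_letter`, which needs them to exclude carries. -/
theorem letter_seedWord_bounds {t : ℕ} (h : t < 20223) :
    2 ≤ letter seedWord t ∧ letter seedWord t ≤ 13 := by
  rcases lt_or_ge t 9 with h9 | h9
  · exact letter_seedWord_of_lt_nine t h9
  · obtain ⟨h1, h2, -⟩ := minimal_longSeed h9 (by omega)
    rw [longSeed, letter_append seedWord_lt, if_pos h] at h1 h2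
    exact ⟨h1, h2⟩

theorem two_le_core (t : ℕ) : 2 ≤ core t := by
  rcases lt_or_ge t 20223 with h | h
  · rw [core_of_lt h]
    exact (letter_seedWord_bounds h).1
  · obtain ⟨m, rfl⟩ := Nat.exists_eq_add_of_le h
    rcases Nat.mod_two_eq_zero_or_one m with h2 | h2
    · rw [core_add_of_even h2]
      split_ifs <;> norm_num
    · rw [core_add, increment_of_odd h2]
      omega

theorem word_eq_letter {n : ℕ} (h : n < 55912) : word n = letter longPrefix n := by
  rw [longPrefix, letter_append prefixWord_lt]
  split_ifs with h1
  · exact word_of_lt h1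
  · obtain ⟨m, rfl⟩ := Nat.exists_eq_add_of_le (not_lt.mp h1)
    rw [Nat.add_sub_cancel_left]
    have key : ∀ r < 24, r % 6 = 3 → letter 0x110100100101100001110000 r = 0 := by decide
    rw [letter_tile_add_spread (by norm_num) rfl
      (fun j _ r hr hr3 => by rw [key r hr hr3, zero_add]; exact letter_lt _ _)
      (by norm_num; omega)]
    split_ifs with h3
    · rw [word_of_eq h3, core_of_lt (by omega),
        key _ (Nat.mod_lt _ (by norm_num)) (by omega), zero_add]
    · rw [word_of_ne h3, add_zero, column]

theorem core_eq_letter {t : ℕ} (h : t < 118527) : core t = letter longSeed t := by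
  rw [longSeed, letter_append seedWord_lt]
  split_ifs with h1
  · exact core_of_lt h1
  · obtain ⟨m, rfl⟩ := Nat.exists_eq_add_of_le (not_lt.mp h1)
    rw [Nat.add_sub_cancel_left]
    have key : ∀ r < 24, letter 0x322223332222332322322323 r =
        letter 0x110100100101100001110000 r + letter 0x21212323 (r % 8) := by decide
    have key' : ∀ r < 24, r % 6 = 3 → letter 0x322223332222332322322323 r = 2 := by decide
    have h8 : m % 24 % 8 = m % 8 := Nat.mod_mod_of_dvd m (by norm_num)
    rw [letter_tile_add_spread (by norm_num) rfl
      (fun j hj r hr hr3 => by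
        have := (letter_seedWord_bounds (t := j) (by omega)).2
        rw [key' r hr hr3]
        omega)
      (by norm_num; omega), core_add]
    split_ifs with h3
    · rw [word_of_eq h3, core_of_lt (by omega),
        key' _ (Nat.mod_lt _ (by norm_num)) (by omega), increment_of_odd (by omega), add_comm]
    · rw [word_of_ne h3, add_zero, key _ (Nat.mod_lt _ (by norm_num)), h8, column, increment]

/-! ### Avoidance of `5/4`-powers -/

/-- `X` has a factor `x y x` starting at `s` with `|x| = l` and `|y| = 3 * l`. -/
def Repeats (X : ℕ → ℕ) (s l : ℕ) : Prop := ∀ i < l, X (s + i) = X (s + i + 4 * l)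

/-- Capping letters at 2 makes the tail periodic with period 24, all of `core` becoming 2. Since `4
* l` modulo 24 depends only on `l % 6`, a finite check suffices. -/
theorem not_repeats_word_of_mod {s l : ℕ} (hs : 6760 ≤ s) (hl : l % 6 ≠ 0) :
    ∃ i < l % 6, word (s + i) ≠ word (s + i + 4 * l) := by
  have key : ∀ r < 6, r ≠ 0 → ∀ m < 24, ∃ i < r,
      letter 0x112100102101102001112000 ((m + i) % 24) ≠
        letter 0x112100102101102001112000 ((m + i + 4 * r) % 24) := by decide +kernel
  have classify : ∀ m, letter 0x112100102101102001112000 (m % 24) = min (word (6760 + m)) 2 := by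
    intro m
    by_cases h3 : m % 6 = 3
    · have k3 : ∀ r < 24, r % 6 = 3 → letter 0x112100102101102001112000 r = 2 := by decide
      rw [word_of_eq h3, k3 _ (Nat.mod_lt _ (by norm_num)) (by omega),
        min_eq_right (two_le_core _)]
    · have k3 : ∀ r < 24, r % 6 ≠ 3 → letter 0x112100102101102001112000 r =
          letter 0x110100100101100001110000 r := by decide
      rw [word_of_ne h3, k3 _ (Nat.mod_lt _ (by norm_num)) (by omega),
        min_eq_left ((column_le_one m).trans one_le_two), column]
  obtain ⟨m, rfl⟩ := Nat.exists_eq_add_of_le hs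
  obtain ⟨i, hi, hne⟩ := key (l % 6) (Nat.mod_lt _ (by norm_num)) hl (m % 24)
    (Nat.mod_lt _ (by norm_num))
  refine ⟨i, hi, fun he => hne ?_⟩
  rw [show (m % 24 + i) % 24 = (m + i) % 24 by omega,
    show (m % 24 + i + 4 * (l % 6)) % 24 = (m + i + 4 * l) % 24 by omega, classify, classify,
    ← add_assoc, he]
  congr 2
  omega

theorem avoids_longPrefix {l : ℕ} (h : l < 8192) : avoids longPrefix 6912 106 6 l = true := by
  rcases lt_or_ge l 4096 with h1 | h1
  · exact forallRange_spec avoids_longPrefix_lower (Nat.zero_le _) (by omega)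
  · exact forallRange_spec avoids_longPrefix_upper h1 (by omega)

theorem avoids_longSeed {l : ℕ} (h : l < 20480) : avoids longSeed 20736 160 7 l = true := by
  rcases lt_or_ge l 4096 with h1 | h1
  · exact forallRange_spec avoids_longSeed_first (Nat.zero_le _) (by omega)
  rcases lt_or_ge l 8192 with h2 | h2
  · exact forallRange_spec avoids_longSeed_second h1 (by omega)
  rcases lt_or_ge l 12288 with h3 | h3
  · exact forallRange_spec avoids_longSeed_third h2 (by omega)
  rcases lt_or_ge l 16384 with h4 | h4
  · exact forallRange_spec avoids_longSeed_fourth h3 (by omega)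
  · exact forallRange_spec avoids_longSeed_fifth h4 (by omega)

theorem not_repeats_word_of_lt {s l : ℕ} (hl : 0 < l) (hs : s < 6760) : ¬ Repeats word s l := by
  intro h
  rcases lt_or_ge (s + l) 6766 with hsl | hsl
  · obtain ⟨i, hi, hne⟩ := avoids_spec (avoids_longPrefix (l := l) (by omega)) hl (s := s)
      (by omega) (by omega)
    apply hne
    rw [← word_eq_letter (by omega), ← word_eq_letter (by omega)]
    exact h i hi
  -- Here `x` covers positions 6760 to 6765, enough for a mismatch unless `6 ∣ l`.
  · have h6 : l % 6 = 0 := by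
      by_contra h6
      obtain ⟨i, hi, hne⟩ := not_repeats_word_of_mod (le_refl 6760) h6
      apply hne
      have := h (6760 - s + i) (by omega)
      rwa [show s + (6760 - s + i) = 6760 + i by omega] at this
    -- As `4 * l - 1` is 23 modulo 24, the letter 2 at position 6759 would have to equal a periodic
    -- letter.
    have h1 := h (6759 - s) (by omega)
    rw [show s + (6759 - s) = 6759 by omega, word_of_lt (by norm_num), letter_prefixWord_last,
      show 6759 + 4 * l = 6760 + (4 * l - 1) by omega, word_of_ne (by omega)] at h1
    have := column_le_one (4 * l - 1)
    omega

/-- The index `(m + 2) / 6` is that of the first `core` letter at or after position `6760 + m`. -/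
theorem repeats_core_of_repeats_word {m k : ℕ} (h : Repeats word (6760 + m) (6 * k)) :
    Repeats core ((m + 2) / 6) k := by
  intro i hi
  have := h (6763 + 6 * ((m + 2) / 6) - (6760 + m) + 6 * i) (by omega)
  rw [core, core]
  convert this using 2 <;> omega

/-- For even `k` the shift `4 * k` is a multiple of 8, so both sides carry the same increment. -/
theorem repeats_word_of_repeats_core {m k l : ℕ} (hk : k % 2 = 0)
    (h : ∀ i < l, core (20223 + m + i) = core (20223 + m + i + 4 * k)) :
    ∀ i < l, word (6760 + m + i) = word (6760 + m + i + 4 * k) := by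
  intro i hi
  have := h i hi
  rw [show 20223 + m + i + 4 * k = 20223 + (m + i + 4 * k) by ring, add_assoc, core_add, core_add,
    increment_congr (show (m + i + 4 * k) % 8 = (m + i) % 8 by omega)] at this
  rw [add_assoc 6760 m i, show 6760 + (m + i) + 4 * k = 6760 + (m + i + 4 * k) by ring]
  omega

theorem core_ne_of_odd {m k : ℕ} (hm : m % 2 = 0) (hk : k % 2 = 1) :
    core (20223 + m) ≠ core (20223 + m + 4 * k) := by
  rw [add_assoc, core_add_of_even hm, core_add_of_even (by omega)]
  split_ifs <;> omega

theorem not_repeats_core_of_lt {t k : ℕ} (hk : 0 < k) (ht : t < 20223) : ¬ Repeats core t k := by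
  intro h
  rcases lt_or_ge (t + k) 20229 with htk | htk
  · obtain ⟨i, hi, hne⟩ := avoids_spec (avoids_longSeed (l := k) (by omega)) hk (s := t)
      (by omega) (by omega)
    apply hne
    rw [← core_eq_letter (by omega), ← core_eq_letter (by omega)]
    exact h i hi
  · have hw : ∀ i < 6, core (20223 + 0 + i) = core (20223 + 0 + i + 4 * k) := fun i hi => by
      have := h (20223 - t + i) (by omega)
      rwa [show t + (20223 - t + i) = 20223 + 0 + i by omega] at this
    rcases Nat.mod_two_eq_zero_or_one k with h2 | h2
    · have h6 : k % 6 = 0 := by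
        by_contra h6
        obtain ⟨i, hi, hne⟩ := not_repeats_word_of_mod (le_refl 6760) h6
        refine hne ?_
        exact repeats_word_of_repeats_core (m := 0) h2 hw i (by omega)
      -- The letter 4 at index 20222 would have to equal a periodic letter plus 2, which is at most
      -- 3.
      have h1 := h (20222 - t) (by omega)
      have e : (4 * k - 1) % 24 = 23 := by omega
      rw [show t + (20222 - t) = 20222 by omega, core_of_lt (by norm_num), letter_seedWord_last,
        show 20222 + 4 * k = 20223 + (4 * k - 1) by omega, core_add, word_of_ne (by omega),
        increment_of_odd (by omega)] at h1
      have := column_le_one (4 * k - 1)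
      omega
    · exact core_ne_of_odd rfl h2 (hw 0 (by norm_num))

theorem not_repeats_core {t k : ℕ} (hk : 0 < k) : ¬ Repeats core t k := by
  induction k using Nat.strong_induction_on generalizing t with
  | _ k ih =>
  rcases lt_or_ge t 20223 with ht | ht
  · exact not_repeats_core_of_lt hk ht
  intro h
  obtain ⟨m, rfl⟩ := Nat.exists_eq_add_of_le ht
  rcases Nat.mod_two_eq_zero_or_one k with h2 | h2
  · have hw := repeats_word_of_repeats_core h2 h
    have h6 : k % 6 = 0 := by
      by_contra h6
      obtain ⟨i, hi, hne⟩ := not_repeats_word_of_mod (show 6760 ≤ 6760 + m by omega) h6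
      exact hne (hw i (hi.trans_le (Nat.mod_le k 6)))
    obtain ⟨j, rfl⟩ := Nat.dvd_of_mod_eq_zero h6
    exact ih j (by omega) (by omega) (repeats_core_of_repeats_word hw)
  · rcases Nat.mod_two_eq_zero_or_one m with hm | hm
    · exact core_ne_of_odd hm h2 (h 0 hk)
    -- From an odd offset the next one is even and gives the mismatch. If `k = 1` there is no next
    -- one, but both increments are 2, so the repetition descends to the word.
    rcases Nat.lt_or_ge 1 k with h1 | h1
    · have := h 1 h1
      rw [add_assoc 20223 m 1] at this
      exact core_ne_of_odd (by omega) h2 this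
    · obtain rfl : k = 1 := by omega
      have := h 0 one_pos
      rw [add_zero, show 20223 + m + 4 * 1 = 20223 + (m + 4) by ring, core_add, core_add,
        increment_of_odd hm, increment_of_odd (by omega)] at this
      obtain ⟨i, hi, hne⟩ := not_repeats_word_of_mod (show 6760 ≤ 6760 + m by omega)
        (show 1 % 6 ≠ 0 by norm_num)
      obtain rfl : i = 0 := by omega
      apply hne
      rw [add_zero, show 6760 + m + 4 * 1 = 6760 + (m + 4) by ring]
      omega

theorem not_repeats_word {s l : ℕ} (hl : 0 < l) : ¬ Repeats word s l := by
  rcases lt_or_ge s 6760 with hs | hs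
  · exact not_repeats_word_of_lt hl hs
  intro h
  have h6 : l % 6 = 0 := by
    by_contra h6
    obtain ⟨i, hi, hne⟩ := not_repeats_word_of_mod hs h6
    exact hne (h i (hi.trans_le (Nat.mod_le l 6)))
  obtain ⟨j, rfl⟩ := Nat.dvd_of_mod_eq_zero h6
  obtain ⟨m, rfl⟩ := Nat.exists_eq_add_of_le hs
  exact not_repeats_core (by omega) (repeats_core_of_repeats_word h)

/-! ### Minimality of the letters -/

theorem column_eq_zero_of_column_eq_one {m : ℕ} (hm : 4 ≤ m) (h3 : m % 6 ≠ 3)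
    (h : column m = 1) : word (6760 + (m - 4)) = 0 := by
  have key : ∀ r < 24, r % 6 ≠ 3 → letter 0x110100100101100001110000 r = 1 →
      (r + 20) % 6 ≠ 3 ∧ letter 0x110100100101100001110000 ((r + 20) % 24) = 0 := by decide
  obtain ⟨h1, h2⟩ := key _ (Nat.mod_lt m (by norm_num)) (by omega) h
  rw [word_of_ne (by omega), column, ← h2]
  congr 1
  omega

theorem word_sub_eight {m : ℕ} (hm : 8 ≤ m) (h3 : m % 6 = 3) : word (6760 + (m - 8)) = 0 := by
  have key : ∀ r < 24, r % 6 = 3 → letter 0x110100100101100001110000 ((r + 16) % 24) = 0 := by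
    decide
  rw [word_of_ne (by omega), column, ← key _ (Nat.mod_lt m (by norm_num)) (by omega)]
  congr 1
  omega

theorem word_sub_four {m : ℕ} (hm : 4 ≤ m) (h3 : m % 6 = 3) : word (6760 + (m - 4)) = 1 := by
  have key : ∀ r < 24, r % 6 = 3 → letter 0x110100100101100001110000 ((r + 20) % 24) = 1 := by
    decide
  rw [word_of_ne (by omega), column, ← key _ (Nat.mod_lt m (by norm_num)) (by omega)]
  congr 1
  omega

theorem word_sub_nine {m : ℕ} (hm : 9 ≤ m) (h3 : m % 6 = 3) :
    word (6760 + (m - 9)) = word (6760 + (m - 1)) := by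
  have key : ∀ r < 24, r % 6 = 3 → letter 0x110100100101100001110000 ((r + 15) % 24) =
    letter 0x110100100101100001110000 ((r + 23) % 24) := by decide
  have := key _ (Nat.mod_lt m (by norm_num)) (by omega)
  rw [word_of_ne (by omega), word_of_ne (by omega), column, column]
  convert this using 2 <;> omega

theorem bans_one {X : ℕ → ℕ} {s c : ℕ} (h : X s = c) : Bans X s 1 c :=
  ⟨one_pos, h, fun i hi => by omega⟩

theorem bans_two {X : ℕ → ℕ} {s c : ℕ} (h : X (s + 1) = c) (h' : X s = X (s + 8)) :
    Bans X s 2 c :=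
  ⟨two_pos, h, fun i hi => by obtain rfl : i = 0 := by omega
                              exact h'⟩

/-- The inflated factor starts just after the letter `core (s - 1)`, so its `x` ends with a `core`
letter; the other columns agree because the shift is `24 * l`. With `s = 0` the start would leave
the periodic region. -/
theorem Bans.word_of_core {s l c : ℕ} (hs : 1 ≤ s) (h : Bans core s l c) :
    Bans word (6760 + (6 * s - 2)) (6 * l) c := by
  obtain ⟨hl, hc, hi⟩ := h
  refine ⟨by omega, ?_, fun i hil => ?_⟩
  · rw [← hc, core]
    congr 1
    omega
  · by_cases h3 : (6 * s - 2 + i) % 6 = 3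
    · rw [add_assoc 6760, add_assoc 6760, word_of_eq h3, word_of_eq (by omega)]
      convert hi ((i - 5) / 6) (by omega) using 2 <;> omega
    · rw [add_assoc 6760, add_assoc 6760, word_of_ne h3, word_of_ne (by omega)]
      exact column_congr (by omega)

theorem Bans.core_of_word {m l c : ℕ} (hl : l % 2 = 0) (h : Bans word (6760 + m) l c) :
    Bans core (20223 + m) l (c + increment (m + l - 1)) := by
  obtain ⟨h0, hc, hi⟩ := h
  refine ⟨h0, ?_, fun i hil => ?_⟩
  · rw [show 20223 + m + l - 1 = 20223 + (m + l - 1) by omega, core_add, ← hc]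
    congr 2
    omega
  · have := hi i hil
    rw [add_assoc 6760, add_assoc 6760] at this
    rw [add_assoc 20223, add_assoc 20223, core_add, core_add, this,
      increment_congr (show (m + i + 4 * l) % 8 = (m + i) % 8 by omega)]

theorem exists_bans_core {t : ℕ} (ht : 9 ≤ t) {c : ℕ} (h2 : 2 ≤ c) (hc : c < core t) :
    ∃ s l, 1 ≤ s ∧ s + 5 * l = t + 1 ∧ Bans core s l c := by
  induction t using Nat.strong_induction_on generalizing c with
  | _ t ih =>
  rcases lt_or_ge t 20480 with h | h
  · rw [core_eq_letter (by omega)] at hc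
    obtain ⟨s, l, hs, hsl, hl, hb, hi⟩ :=
      (minimal_longSeed ht h).2.2 c h2 hc
    refine ⟨s, l, hs, hsl, hl, ?_, fun i hil => ?_⟩
    · rw [core_eq_letter (by omega), hb]
    · rw [core_eq_letter (by omega), core_eq_letter (by omega), hi i hil]
  obtain ⟨m, rfl⟩ := Nat.exists_eq_add_of_le (show 20223 ≤ t by omega)
  rcases Nat.mod_two_eq_zero_or_one m with hm | hm
  -- Only 2 below a letter 3 has to be excluded, and the letter four places earlier is then 2.
  · refine ⟨20223 + (m - 4), 1, by omega, by omega, bans_one ?_⟩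
    rw [core_add_of_even hm] at hc
    rw [core_add_of_even (by omega)]
    split_ifs at hc ⊢ <;> omega
  obtain ⟨d, rfl⟩ := Nat.exists_eq_add_of_le' h2
  rw [core_add, increment_of_odd hm] at hc
  by_cases h3 : m % 6 = 3
  -- The values 2 and 3 are the raised 0 and 1 standing eight and four places earlier.
  · rcases d with _ | _ | d
    · refine ⟨20223 + (m - 9), 2, by omega, by omega, bans_two ?_ ?_⟩
      · rw [show 20223 + (m - 9) + 1 = 20223 + (m - 8) by omega, core_add,
          word_sub_eight (by omega) h3, increment_of_odd (by omega)]
      · rw [show 20223 + (m - 9) + 8 = 20223 + (m - 1) by omega, core_add, core_add,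
          word_sub_nine (by omega) h3,
          increment_congr (show (m - 9) % 8 = (m - 1) % 8 by omega)]
    · refine ⟨20223 + (m - 4), 1, by omega, by omega, bans_one ?_⟩
      rw [core_add, word_sub_four (by omega) h3, increment_of_odd (by omega)]
    -- The value `d + 4` arises from `d + 2` at index `m / 6`: inflate that power by 6, then raise
    -- by the increment 2.
    · rw [word_of_eq h3] at hc
      obtain ⟨s, l, hs, hsl, hb⟩ := ih (m / 6) (by omega) (by omega) (c := d + 2) (by omega)
        (by omega)
      refine ⟨20223 + (6 * s - 2), 6 * l, by omega, by omega, ?_⟩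
      have := (hb.word_of_core hs).core_of_word (by omega)
      have hl := hb.1
      rwa [increment_of_odd (by omega)] at this
  · refine ⟨20223 + (m - 4), 1, by omega, by omega, bans_one ?_⟩
    rw [word_of_ne h3] at hc
    have h1 := column_le_one m
    rw [core_add, column_eq_zero_of_column_eq_one (by omega) h3 (by omega),
      increment_of_odd (by omega)]
    omega

theorem exists_bans_word {n c : ℕ} (hc : c < word n) :
    ∃ s l, s + 5 * l = n + 1 ∧ Bans word s l c := by
  rcases lt_or_ge n 6848 with h | h
  · rw [word_eq_letter (by omega)] at hc
    obtain ⟨s, l, -, hsl, hl, hb, hi⟩ := (minimalOn_spec (j := n / 107) le_rfl (by norm_num)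
      (forallRange_spec minimalOn_longPrefix (Nat.zero_le _) (by omega)) (Nat.zero_le n)
      (by omega) (by omega)).2.2 c (Nat.zero_le c) hc
    refine ⟨s, l, hsl, hl, ?_, fun i hil => ?_⟩
    · rw [word_eq_letter (by omega), hb]
    · rw [word_eq_letter (by omega), word_eq_letter (by omega), hi i hil]
  obtain ⟨m, rfl⟩ := Nat.exists_eq_add_of_le (show 6760 ≤ n by omega)
  by_cases h3 : m % 6 = 3
  · rcases c with _ | _ | c
    · refine ⟨6760 + (m - 9), 2, by omega, bans_two ?_ ?_⟩
      · rw [show 6760 + (m - 9) + 1 = 6760 + (m - 8) by omega, word_sub_eight (by omega) h3]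
      · rw [show 6760 + (m - 9) + 8 = 6760 + (m - 1) by omega, word_sub_nine (by omega) h3]
    · exact ⟨6760 + (m - 4), 1, by omega, bans_one (word_sub_four (by omega) h3)⟩
    · rw [word_of_eq h3] at hc
      obtain ⟨s, l, hs, hsl, hb⟩ := exists_bans_core (by omega) (by omega) hc
      exact ⟨_, _, by omega, hb.word_of_core hs⟩
  · rw [word_of_ne h3] at hc
    have h1 := column_le_one m
    refine ⟨6760 + (m - 4), 1, by omega, bans_one ?_⟩
    rw [column_eq_zero_of_column_eq_one (by omega) h3 (by omega)]
    omega

/-! ### The structure of the word -/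

theorem factor_add {α : Type*} (w : ℕ → α) (i m n : ℕ) :
    factor w i (m + n) = factor w i m ++ factor w (i + m) n := by
  simp [factor, List.range_add, Function.comp_def, add_assoc]

theorem length_factor {α : Type*} (w : ℕ → α) (i m : ℕ) : (factor w i m).length = m := by
  simp [factor]

theorem factor_congr {α : Type*} {v w : ℕ → α} {i j m : ℕ}
    (h : ∀ k < m, v (i + k) = w (j + k)) : factor v i m = factor w j m :=
  List.map_congr_left fun k hk => h k (List.mem_range.mp hk)

theorem isFiveFourthsPower_factor_iff {α : Type*} {w : ℕ → α} {i m : ℕ} :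
    IsFiveFourthsPower (factor w i m) ↔
      ∃ l, 0 < l ∧ m = 5 * l ∧ ∀ k < l, w (i + k) = w (i + k + 4 * l) := by
  constructor
  · rintro ⟨x, y, hx, hy, h⟩
    have hm := congrArg List.length h
    simp only [length_factor, List.length_append] at hm
    obtain rfl : m = x.length + 3 * x.length + x.length := by omega
    rw [factor_add, factor_add] at h
    obtain ⟨h1, h2⟩ := List.append_inj h (by simp [length_factor, hy])
    obtain ⟨h3, -⟩ := List.append_inj h1 (by simp [length_factor])
    refine ⟨x.length, List.length_pos_of_ne_nil hx, by ring, fun k hk => ?_⟩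
    have h4 := h3.trans h2.symm
    have := List.map_inj_left.mp (show (List.range x.length).map (fun k => w (i + k)) =
      (List.range x.length).map (fun k => w (i + (x.length + 3 * x.length) + k)) from h4) k
      (List.mem_range.mpr hk)
    rw [this]
    congr 1
    ring
  · rintro ⟨l, hl, rfl, h⟩
    refine ⟨factor w i l, factor w (i + l) (3 * l), ?_, by simp [length_factor], ?_⟩
    · rw [← List.length_pos_iff, length_factor]
      exact hl
    · rw [show 5 * l = l + 3 * l + l by ring, factor_add, factor_add]
      congr 1
      refine factor_congr fun k hk => ?_
      rw [h k hk]
      congr 1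
      ring

/-! ### Lexicographic leastness. -/

theorem fiveFourthsPowerFree_word : FiveFourthsPowerFree word := by
  intro i m h
  obtain ⟨l, hl, -, hr⟩ := isFiveFourthsPower_factor_iff.mp h
  exact not_repeats_word hl hr

theorem hasFiveFourthsPowerEndingAt_of_lt {v : ℕ → ℕ} {n : ℕ} (heq : ∀ k < n, v k = word k)
    (hlt : v n < word n) : HasFiveFourthsPowerEndingAt v n := by
  obtain ⟨s, l, hsl, hl, hc, hi⟩ := exists_bans_word hlt
  refine ⟨s, 5 * l, hsl, isFiveFourthsPower_factor_iff.mpr ⟨l, hl, rfl, fun k hk => ?_⟩⟩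
  rcases Nat.lt_or_ge (k + 1) l with h | h
  · rw [heq _ (by omega), heq _ (by omega), hi k h]
  · rw [show s + k + 4 * l = n by omega, show s + k = s + l - 1 by omega, heq _ (by omega), hc]

theorem isLexLeast_word : IsLexLeastFiveFourthsPowerFree word := by
  refine ⟨fiveFourthsPowerFree_word, fun v hv => ?_⟩
  by_contra hlt
  obtain ⟨n, heq, hn⟩ := not_le.mp hlt
  obtain ⟨i, m, -, h⟩ := hasFiveFourthsPowerEndingAt_of_lt (v := ofLex v) heq hn
  exact hv i m h

/-- The infinite word `z φ(z) φ²(z) ⋯`. -/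
def lift (k : ℕ) : Sigma8 := ((core (k + 1) : ℤ) - increment (k + 2), Fin.ofNat 8 (k + 2))

/-! ### The morphic description of the tail. -/

theorem ofNat_congr {m n : ℕ} (h : m % 8 = n % 8) : Fin.ofNat 8 m = Fin.ofNat 8 n := Fin.ext h

theorem tau_lift_add (m : ℕ) : tau (lift (20226 + m)) = word (6764 + m) := by
  rw [tau, lift, show 20226 + m + 1 = 20223 + (m + 4) by ring, core_add,
    increment_congr (show (20226 + m + 2) % 8 = (m + 4) % 8 by omega),
    show 6760 + (m + 4) = 6764 + m by ring]
  push_cast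
  ring

/-- Both sides depend on `k` modulo 8 only, since `6 * 8` is a multiple of 24 and of 8; eight cases
remain. -/
theorem phi_eq (n : ℤ) (k : ℕ) : phi (n, Fin.ofNat 8 (k + 2)) =
    (List.range 6).map fun i => (if i = 5 then n + increment (k + 2) else column (6 * k + 4 + i),
      Fin.ofNat 8 (6 * k + 4 + i)) := by
  have h1 : Fin.ofNat 8 (k + 2) = Fin.ofNat 8 (k % 8 + 2) := ofNat_congr (by omega)
  have h2 : ∀ i, Fin.ofNat 8 (6 * k + 4 + i) = Fin.ofNat 8 (6 * (k % 8) + 4 + i) := fun i =>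
    ofNat_congr (by omega)
  have h3 : ∀ i, column (6 * k + 4 + i) = column (6 * (k % 8) + 4 + i) := fun i =>
    column_congr (by omega)
  have h4 : increment (k + 2) = increment (k % 8 + 2) := increment_congr (by omega)
  simp only [h1, h2, h3, h4]
  have h5 : k % 8 < 8 := Nat.mod_lt _ (by norm_num)
  generalize k % 8 = r at h5
  interval_cases r <;> rfl

/-- Blocks begin at offset 4 from position 6760, so that the `core` letter comes last: `6 * k + 4 +
5` is 3 modulo 6. -/
theorem phi_lift (k : ℕ) : phi (lift k) = factor lift (20226 + 6 * k) 6 := by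
  rw [lift, phi_eq]
  refine List.map_congr_left fun i hi => ?_
  rw [List.mem_range] at hi
  refine Prod.ext ?_ ?_
  · change _ = tau (lift (20226 + 6 * k + i))
    rw [add_assoc 20226, tau_lift_add, show 6764 + (6 * k + i) = 6760 + (6 * k + 4 + i) by ring]
    dsimp only
    split_ifs with h
    · subst h
      rw [word_of_eq (by omega), show (6 * k + 4 + 5) / 6 = k + 1 by omega]
      ring
    · rw [word_of_ne (by omega)]
  · exact ofNat_congr (by omega)

theorem phiWord_factor_lift (a n : ℕ) :
    phiWord (factor lift a n) = factor lift (20226 + 6 * a) (6 * n) := by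
  induction n with
  | zero => rfl
  | succ n ih =>
    have h1 : factor lift (a + n) 1 = [lift (a + n)] := rfl
    rw [mul_add, factor_add, factor_add, ← ih, h1, phiWord, phiWord, List.flatMap_append,
      List.flatMap_singleton, phi_lift]
    congr 2
    ring

/-- The total length of `z, φ(z), …, φ^(k-1)(z)`. -/
def start : ℕ → ℕ
  | 0 => 0
  | k + 1 => 20226 + 6 * start k

theorem start_add_one (k : ℕ) : start (k + 1) = 20226 + 6 * start k := rfl

theorem start_succ (k : ℕ) : start (k + 1) = start k + 20226 * 6 ^ k := by
  induction k with
  | zero => rfl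
  | succ k ih =>
    rw [start_add_one, ih, pow_succ]
    rw [start_add_one] at ih
    omega

theorem iterate_phiWord (k : ℕ) :
    phiWord^[k] (factor lift 0 20226) = factor lift (start k) (20226 * 6 ^ k) := by
  induction k with
  | zero => rfl
  | succ k ih =>
    rw [Function.iterate_succ_apply', ih, phiWord_factor_lift, start_add_one, pow_succ]
    congr 1
    ring

/-- The iterated images of the first 20226 letters are adjacent factors of `lift`, so they
concatenate to a factor. -/
theorem flatMap_iterate_phiWord (k : ℕ) :
    (List.range k).flatMap (fun k => phiWord^[k + 1] (factor lift 0 20226)) =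
      factor lift 20226 (6 * start k) := by
  induction k with
  | zero => rfl
  | succ k ih =>
    rw [List.range_succ, List.flatMap_append, ih, List.flatMap_singleton, iterate_phiWord,
      start_succ, mul_add, factor_add, ← start_succ, start_add_one, pow_succ]
    congr 2
    ring

theorem lt_start (n : ℕ) : n < 6 * start (n + 1) := by
  induction n with
  | zero => simp [start]
  | succ n ih => rw [start_add_one]; omega

theorem concatWord_iterate_phiWord (n : ℕ) :
    concatWord (fun k => phiWord^[k + 1] (factor lift 0 20226)) n = lift (20226 + n) := by
  rw [concatWord, flatMap_iterate_phiWord, List.getD_eq_getElem _ _ (by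
    rw [length_factor]
    exact lt_start n)]
  simp [factor]

theorem subscriptIncreasing_factor_lift (a n : ℕ) : SubscriptIncreasing (factor lift a n) := by
  rw [SubscriptIncreasing, List.isChain_iff_getElem]
  intro i hi
  simp only [factor, List.getElem_map, List.getElem_range, lift]
  rw [← add_assoc]
  ext
  simp only [Fin.ofNat, Fin.val_add]
  omega

/-- Replaces the recursively defined `core` by digits, so that the two ends of `z` can be evaluated.
-/
theorem factor_lift_eq {a n : ℕ} (h : a + n < 118526) : factor lift a n =
    factor (fun k => ((letter longSeed (k + 1) : ℤ) - increment (k + 2),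
      Fin.ofNat 8 (k + 2))) a n :=
  factor_congr fun k hk => by rw [lift, core_eq_letter (by omega)]

theorem factor_lift_first : factor lift 0 12 =
    [(0, 2), (0, 3), (3, 4), (0, 5), (1, 6), (1, 7),
      (-1, 0), (2, 1), (0, 2), (2, 3), (2, 4), (0, 5)] := by
  rw [factor_lift_eq (by norm_num)]
  decide +kernel

theorem factor_lift_last : factor lift 20214 12 =
    [(0, 0), (1, 1), (0, 2), (0, 3), (1, 4), (2, 5),
      (1, 6), (2, 7), (0, 0), (0, 1), (0, 2), (3, 3)] := by
  rw [factor_lift_eq (by norm_num)]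
  decide +kernel

end FiveFourths

open FiveFourths

theorem theorem1 :
    ∃ w : ℕ → ℕ,
      IsLexLeastFiveFourthsPowerFree w ∧
      (∀ n c : ℕ, c < w n → HasFiveFourthsPowerEndingAt (Function.update w n c) n) ∧
      ∃ (p : List ℕ) (z : List Sigma8),
        p.length = 6764 ∧
        p = factor w 0 6764 ∧
        z.length = 20226 ∧
        SubscriptIncreasing z ∧
        [(0, 2), (0, 3), (3, 4), (0, 5), (1, 6), (1, 7),
          (-1, 0), (2, 1), (0, 2), (2, 3), (2, 4), (0, 5)] <+: z ∧
        [(0, 0), (1, 1), (0, 2), (0, 3), (1, 4), (2, 5),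
          (1, 6), (2, 7), (0, 0), (0, 1), (0, 2), (3, 3)] <:+ z ∧
        (phiWord z).map tau =
          (factor w 6764 (6 * 20226)).map (fun a : ℕ => (a : ℤ)) ∧
        (fun n => (w n : ℤ)) =
          prependWord (p.map (fun a : ℕ => (a : ℤ)))
            (fun n => tau (concatWord (fun k => phiWord^[k + 1] z) n)) := by
  refine ⟨word, isLexLeast_word, fun n c hc => ?_, factor word 0 6764, factor lift 0 20226,
    length_factor _ _ _, rfl, length_factor _ _ _, subscriptIncreasing_factor_lift _ _, ?_, ?_,
    ?_, ?_⟩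
  · refine hasFiveFourthsPowerEndingAt_of_lt (fun k hk => ?_) ?_
    · rw [Function.update_of_ne hk.ne]
    · rwa [Function.update_self]
  · rw [← factor_lift_first]
    exact ⟨_, (factor_add lift 0 12 20214).symm⟩
  · rw [← factor_lift_last]
    exact ⟨_, (factor_add lift 0 20214 12).symm⟩
  · rw [phiWord_factor_lift, factor, factor, List.map_map, List.map_map]
    exact List.map_congr_left fun k _ => tau_lift_add k
  · funext n
    rw [prependWord]
    split_ifs with h
    · simp [factor]
    · rw [List.length_map, length_factor] at h ⊢
      rw [concatWord_iterate_phiWord, tau_lift_add,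
        Nat.add_sub_of_le (not_lt.mp h)]
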